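/- Let $J=\begin{pmatrix}0&1\\-1&0\end{pmatrix}$ and $Q=\begin{pmatrix}0&I_3\\I_3&0\end{pmatrix}$, let $SL_2=SL_2(\mathbb C)$ act on $\mathrm{Mat}_{2\times 6}(\mathbb C)$ by left multiplication, and let $\mu^{-1}(0)\subset \mathrm{Mat}_{2\times 6}$ be the scheme-theoretic zero fibre of the moment map $\mu(M)=MQM^tJ$. Let $SO_6=\{g\mid g^tQg=Q,\ \det g=1\}$, $\mathfrak{so}_6=\{A\mid A^tQ+QA=0\}$, and let $O_{[2^2,1^2]}$ be the nilpotent $SO_6$-orbit, under conjugation, of the matrix $A_0=(a_{ij})$ with $a_{15}=-a_{24}=1$ and all other entries $0$ (it has Jordan type $[2^2,1^2]$). Let $$\overline O_{[2^2,1^2]}=\{A\in\mathfrak{so}_6\mid A^2=0,\ \operatorname{rk}A\le 2,\ \operatorname{Pf}_4(QA)=0\}$$ be the closed subscheme of $\mathrm{Mat}_{6\times 6}$ defined by these equations, where $\operatorname{Pf}_4(QA)$ denotes the Pfaffians of the skew-symmetric $4\times 4$ submatrices of $QA$ and the rank condition means the vanishing of the $3\times3$ minors. Let $\nu\colon\mu^{-1}(0)\to\overline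 O_{[2^2,1^2]}$, $M\mapsto M^tJMQ$, be the morphism given by this formula (the quotient map of the $SL_2$-action). Then $\overline O_{[2^2,1^2]}$ has complex points $O_{[2^2,1^2]}\cup\{0\}$, and $O_{[2^2,1^2]}$ is the set of closed points of a dense open reduced subscheme of it. The restriction $\nu^{-1}(O_{[2^2,1^2]})\to O_{[2^2,1^2]}$ of $\nu$ is flat, and its scheme-theoretic fibres over all (complex) points of $O_{[2^2,1^2]}$ are isomorphic over $\mathbb C$ to each other. Every such fibre $F=\nu^{-1}(A)$ is $SL_2$-equivariantly isomorphic to $SL_2$ (with the action by left multiplication). Its Hilbert function is $h(d)=\dim\operatorname{Hom}_{SL_2}(V_d,\mathbb C[F])=d+1$ for all $d\ge 0$, where $V_d=\mathbb C[x,y]_d$ is the irreducible representation of $SL_2$ of dimension $d+1$. -/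

import Mathlib

open AlgebraicGeometry CategoryTheory
open scoped MatrixGroups

noncomputable section

namespace SymplecticReduction

/-- The index set of the six columns, written as `3 + 3`: `Sum.inl i` is the column `i`, and
`Sum.inr i` is the column `3 + i`. -/
abbrev Idx : Type := Fin 3 ⊕ Fin 3

/-- `J = (0, 1; -1, 0)`. -/
def formJ (R : Type*) [CommRing R] : Matrix (Fin 2) (Fin 2) R := !![0, 1; -1, 0]

/-- `Q = (0, I₃; I₃, 0)`. -/
def formQ (R : Type*) [CommRing R] : Matrix Idx Idx R := Matrix.fromBlocks 0 1 1 0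

/-- The moment map `μ(M) = M Q Mᵗ J` of the `SL₂`-action on `2 × 6` matrices. -/
def momentMap {R : Type*} [CommRing R] (M : Matrix (Fin 2) Idx R) : Matrix (Fin 2) (Fin 2) R :=
  M * formQ R * M.transpose * formJ R

/-- The formula `ν(M) = Mᵗ J M Q` of the quotient map. -/
def nuMap {R : Type*} [CommRing R] (M : Matrix (Fin 2) Idx R) : Matrix Idx Idx R :=
  M.transpose * formJ R * M * formQ R

/-! ### The zero fibre of the moment map -/

/-- The generic matrix with two rows and columns indexed by `κ`. -/
def genM (κ : Type) : Matrix (Fin 2) κ (MvPolynomial (Fin 2 × κ) ℂ) :=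
  Matrix.mvPolynomialX (Fin 2) κ ℂ

/-- The ideal of the scheme-theoretic fibre `μ⁻¹(0)`, generated by the entries of `M Q Mᵗ J`. -/
def zeroFibreIdeal : Ideal (MvPolynomial (Fin 2 × Idx) ℂ) :=
  Ideal.span (Set.range fun p : Fin 2 × Fin 2 => momentMap (genM Idx) p.1 p.2)

/-- The coordinate ring `ℂ[μ⁻¹(0)]`. -/
abbrev ZeroFibreRing : Type := MvPolynomial (Fin 2 × Idx) ℂ ⧸ zeroFibreIdeal

/-! ### The nilpotent orbit and its closure -/

/-- The Pfaffian of the skew-symmetric `4 × 4` submatrix of `B` on the rows and columns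
`i, j, k, l` (zero when an index is repeated). -/
def pf4 {R : Type*} [CommRing R] (B : Matrix Idx Idx R) (i j k l : Idx) : R :=
  B i j * B k l - B i k * B j l + B i l * B j k

/-- The polynomial equations of
`{A ∈ 𝔰𝔬₆ | A² = 0, rk A ≤ 2, Pf₄(QA) = 0}`, where `𝔰𝔬₆ = {A | AᵗQ + QA = 0}`: an element of this
set is the left-hand side of one of the equations. -/
def closureEquations {R : Type*} [CommRing R] (A : Matrix Idx Idx R) : Set R :=
  (Set.range fun p : Idx × Idx => (A.transpose * formQ R + formQ R * A) p.1 p.2) ∪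
  (Set.range fun p : Idx × Idx => (A * A) p.1 p.2) ∪
  (Set.range fun p : (Fin 3 → Idx) × (Fin 3 → Idx) => (A.submatrix p.1 p.2).det) ∪
  (Set.range fun p : (Idx × Idx) × (Idx × Idx) =>
    pf4 (formQ R * A) p.1.1 p.1.2 p.2.1 p.2.2)

/-- The complex points of the orbit closure. -/
def orbitClosure : Set (Matrix Idx Idx ℂ) :=
  {A | ∀ f ∈ closureEquations A, f = 0}

/-- The generic `6 × 6` matrix. -/
def genA : Matrix Idx Idx (MvPolynomial (Idx × Idx) ℂ) := Matrix.mvPolynomialX Idx Idx ℂ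

/-- The ideal generated by the equations of the orbit closure. -/
def orbitClosureIdeal : Ideal (MvPolynomial (Idx × Idx) ℂ) :=
  Ideal.span (closureEquations genA)

/-- The coordinate ring of the orbit closure. -/
abbrev OrbitClosureRing : Type := MvPolynomial (Idx × Idx) ℂ ⧸ orbitClosureIdeal

/-- The matrix `A₀` with `a₁₅ = 1`, `a₂₄ = -1` and all other entries zero. It satisfies
`A₀² = 0` and has rank `2`, so it has Jordan type `[2², 1²]`. -/
def basePoint : Matrix Idx Idx ℂ :=
  Matrix.fromBlocks 0 !![0, 1, 0; -1, 0, 0; 0, 0, 0] 0 0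

/-- The nilpotent orbit `O_{[2²,1²]}`: the orbit of `A₀` under the adjoint action of
`SO₆ = {g | gᵗQg = Q, det g = 1}`. -/
def nilpotentOrbit : Set (Matrix Idx Idx ℂ) :=
  {A | ∃ g : Matrix Idx Idx ℂ, g.transpose * formQ ℂ * g = formQ ℂ ∧ g.det = 1 ∧
    A = g * basePoint * g⁻¹}

/-- `closureEquations` is compatible with ring homomorphisms. -/
theorem closureEquations_map {R S : Type*} [CommRing R] [CommRing S] (φ : R →+* S)
    (A : Matrix Idx Idx R) {f : R} (hf : f ∈ closureEquations A) :
    φ f ∈ closureEquations (A.map φ) := by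
  have hQ : formQ S = (formQ R).map φ := by
    ext (i | i) (j | j) <;> simp [formQ, Matrix.one_apply, apply_ite φ]
  rcases hf with ((⟨p, rfl⟩ | ⟨p, rfl⟩) | ⟨p, rfl⟩) | ⟨p, rfl⟩
  · refine Or.inl (Or.inl (Or.inl ⟨p, ?_⟩))
    simp [hQ, Matrix.mul_apply, Matrix.add_apply]
  · refine Or.inl (Or.inl (Or.inr ⟨p, ?_⟩))
    simp [Matrix.mul_apply]
  · refine Or.inl (Or.inr ⟨p, ?_⟩)
    simp only [RingHom.map_det, RingHom.mapMatrix_apply, Matrix.submatrix_map]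
  · refine Or.inr ⟨p, ?_⟩
    simp [pf4, hQ, Matrix.mul_apply]

/-- If `M Q Mᵗ J = 0`, then `Mᵗ J M Q` satisfies the equations of the orbit closure. -/
theorem closureEquations_nuMap {R : Type*} [CommRing R] (M : Matrix (Fin 2) Idx R)
    (hM : momentMap M = 0) : ∀ f ∈ closureEquations (nuMap M), f = 0 := by
  have hJ : formJ R * formJ R = -1 := by
    ext i j; fin_cases i <;> fin_cases j <;> simp [formJ]
  have hQ : formQ R * formQ R = 1 := by
    simp [formQ, Matrix.fromBlocks_multiply]
  have hQt : (formQ R).transpose = formQ R := by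
    simp [formQ, Matrix.fromBlocks_transpose]
  have hJt : (formJ R).transpose = -formJ R := by
    ext i j; fin_cases i <;> fin_cases j <;> simp [formJ]
  have h0 : M * formQ R * M.transpose = 0 := by
    have h := congrArg (· * formJ R) hM
    simp only [momentMap, Matrix.mul_assoc, hJ, Matrix.zero_mul] at h
    simpa [Matrix.mul_assoc] using h
  have hB : ∀ i j, (formQ R * nuMap M) i j =
      (M * formQ R) 0 i * (M * formQ R) 1 j - (M * formQ R) 1 i * (M * formQ R) 0 j := by
    have : formQ R * nuMap M = (M * formQ R).transpose * formJ R * (M * formQ R) := by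
      rw [Matrix.transpose_mul, hQt, nuMap]; simp only [Matrix.mul_assoc]
    intro i j
    rw [this]
    generalize M * formQ R = N
    simp [Matrix.mul_apply, Fin.sum_univ_two, formJ]
    ring
  rintro f (((⟨p, rfl⟩ | ⟨p, rfl⟩) | ⟨p, rfl⟩) | ⟨p, rfl⟩)
  · have : (nuMap M).transpose * formQ R + formQ R * nuMap M = 0 := by
      simp only [nuMap, Matrix.transpose_mul, Matrix.transpose_transpose, hQt, hJt,
        Matrix.mul_assoc, Matrix.neg_mul, Matrix.mul_neg]
      simp
    exact congrFun (congrFun this _) _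
  · have : nuMap M * nuMap M = 0 := by
      have : nuMap M * nuMap M =
          M.transpose * formJ R * (M * formQ R * M.transpose) * formJ R * M * formQ R := by
        simp only [nuMap, Matrix.mul_assoc]
      rw [this, h0]; simp
    exact congrFun (congrFun this _) _
  · have hA : ∀ i j, nuMap M i j =
        M 0 i * (M * formQ R) 1 j - M 1 i * (M * formQ R) 0 j := by
      have : nuMap M = M.transpose * formJ R * (M * formQ R) := by
        simp only [nuMap, Matrix.mul_assoc]
      intro i j
      rw [this]
      generalize M * formQ R = N
      simp [Matrix.mul_apply, Fin.sum_univ_two, formJ]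
      ring
    simp only [Matrix.det_fin_three, Matrix.submatrix_apply, hA]
    ring
  · simp only [pf4, hB]
    ring

theorem formQ_map {R S : Type*} [CommRing R] [CommRing S] (φ : R →+* S) :
    (formQ R).map φ = formQ S := by
  ext (i | i) (j | j) <;> simp [formQ, Matrix.one_apply, apply_ite φ]

theorem formJ_map {R S : Type*} [CommRing R] [CommRing S] (φ : R →+* S) :
    (formJ R).map φ = formJ S := by
  ext i j; fin_cases i <;> fin_cases j <;> simp [formJ]

theorem momentMap_map {R S : Type*} [CommRing R] [CommRing S] (φ : R →+* S)
    (M : Matrix (Fin 2) Idx R) : momentMap (M.map φ) = (momentMap M).map φ := by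
  simp only [momentMap, Matrix.map_mul, formQ_map, formJ_map, Matrix.transpose_map]

theorem nuMap_map {R S : Type*} [CommRing R] [CommRing S] (φ : R →+* S)
    (M : Matrix (Fin 2) Idx R) : nuMap (M.map φ) = (nuMap M).map φ := by
  simp only [nuMap, Matrix.map_mul, formQ_map, formJ_map, Matrix.transpose_map]

theorem momentMap_generic_eq_zero :
    momentMap ((genM Idx).map (Ideal.Quotient.mk zeroFibreIdeal)) = 0 := by
  rw [momentMap_map]
  ext i j
  exact Ideal.Quotient.eq_zero_iff_mem.mpr (Ideal.subset_span ⟨(i, j), rfl⟩)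

/-- The comorphism of `ν`: the coordinate `a_{ij}` is sent to the `(i, j)` entry of `Mᵗ J M Q`. -/
def nuComorphism : OrbitClosureRing →ₐ[ℂ] ZeroFibreRing :=
  Ideal.Quotient.liftₐ orbitClosureIdeal
    (MvPolynomial.aeval fun p : Idx × Idx =>
      nuMap ((genM Idx).map (Ideal.Quotient.mk zeroFibreIdeal)) p.1 p.2) (by
    intro a ha
    have hle : orbitClosureIdeal ≤ RingHom.ker (MvPolynomial.aeval (R := ℂ) fun p : Idx × Idx =>
        nuMap ((genM Idx).map (Ideal.Quotient.mk zeroFibreIdeal)) p.1 p.2).toRingHom := by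
      refine Ideal.span_le.mpr fun f hf => ?_
      have h := closureEquations_map (MvPolynomial.aeval (R := ℂ) fun p : Idx × Idx =>
        nuMap ((genM Idx).map (Ideal.Quotient.mk zeroFibreIdeal)) p.1 p.2).toRingHom genA hf
      have hA : genA.map (MvPolynomial.aeval (R := ℂ) fun p : Idx × Idx =>
          nuMap ((genM Idx).map (Ideal.Quotient.mk zeroFibreIdeal)) p.1 p.2).toRingHom =
          nuMap ((genM Idx).map (Ideal.Quotient.mk zeroFibreIdeal)) := by
        ext i j; simp [genA]
      rw [hA] at h
      exact closureEquations_nuMap _ momentMap_generic_eq_zero _ h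
    exact hle ha)

/-- The affine scheme `μ⁻¹(0)`. -/
def zeroFibre : Scheme := Spec (CommRingCat.of ZeroFibreRing)

/-- The orbit closure as an affine scheme. -/
def orbitClosureScheme : Scheme := Spec (CommRingCat.of OrbitClosureRing)

/-- The morphism `ν : μ⁻¹(0) → Ō_{[2²,1²]}`, `M ↦ Mᵗ J M Q`. -/
def nu : zeroFibre ⟶ orbitClosureScheme :=
  Spec.map (CommRingCat.ofHom nuComorphism.toRingHom)

/-- Evaluation of functions on the orbit closure at one of its complex points. -/
def evalAt (A : Matrix Idx Idx ℂ) (hA : A ∈ orbitClosure) : OrbitClosureRing →ₐ[ℂ] ℂ :=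
  Ideal.Quotient.liftₐ orbitClosureIdeal
    (MvPolynomial.aeval fun p : Idx × Idx => A p.1 p.2) (by
    intro a ha
    have hle : orbitClosureIdeal ≤ RingHom.ker
        (MvPolynomial.aeval (R := ℂ) fun p : Idx × Idx => A p.1 p.2).toRingHom := by
      refine Ideal.span_le.mpr fun f hf => ?_
      have h := closureEquations_map
        (MvPolynomial.aeval (R := ℂ) fun p : Idx × Idx => A p.1 p.2).toRingHom genA hf
      have hA' : genA.map
          (MvPolynomial.aeval (R := ℂ) fun p : Idx × Idx => A p.1 p.2).toRingHom = A := by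
        ext i j; simp [genA]
      rw [hA'] at h
      exact hA _ h
    exact hle ha)

/-- The closed point of the scheme given by a complex point. -/
def closedPoint (A : Matrix Idx Idx ℂ) (hA : A ∈ orbitClosure) : orbitClosureScheme :=
  PrimeSpectrum.comap (evalAt A hA).toRingHom ⊥

/-- The ideal of the scheme-theoretic fibre `ν⁻¹(A)` in `ℂ[μ⁻¹(0)]`: the extension of the maximal
ideal of `A`. -/
def fibreIdeal (A : Matrix Idx Idx ℂ) (hA : A ∈ orbitClosure) : Ideal ZeroFibreRing :=
  (RingHom.ker (evalAt A hA).toRingHom).map nuComorphism.toRingHom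

/-- The coordinate ring of the scheme-theoretic fibre `ν⁻¹(A)`. -/
abbrev FibreRing (A : Matrix Idx Idx ℂ) (hA : A ∈ orbitClosure) : Type :=
  ZeroFibreRing ⧸ fibreIdeal A hA

/-- The coordinate ring of the variety `SL₂`. -/
abbrev SL2Ring : Type :=
  MvPolynomial (Fin 2 × Fin 2) ℂ ⧸ Ideal.span {(genM (Fin 2)).det - 1}

/-! ### The action of `SL₂` -/

/-- The matrix `g` with its entries viewed as constant polynomials. -/
def scalarMatrix (κ : Type) (g : SL(2, ℂ)) :
    Matrix (Fin 2) (Fin 2) (MvPolynomial (Fin 2 × κ) ℂ) :=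
  MvPolynomial.C.mapMatrix (g : Matrix (Fin 2) (Fin 2) ℂ)

theorem scalarMatrix_det (κ : Type) (g : SL(2, ℂ)) : (scalarMatrix κ g).det = 1 := by
  rw [scalarMatrix, ← RingHom.map_det, g.2, map_one]

/-- The matrix `g⁻¹ X` of linear forms, where `X` is the generic matrix. -/
def translated (κ : Type) (g : SL(2, ℂ)) : Matrix (Fin 2) κ (MvPolynomial (Fin 2 × κ) ℂ) :=
  scalarMatrix κ g⁻¹ * genM κ

/-- The action of `SL₂(ℂ)` on polynomial functions on matrices with two rows, induced by left
multiplication: `(g f)(M) = f(g⁻¹ M)`. -/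
def polyAction (κ : Type) :
    SL(2, ℂ) →* (MvPolynomial (Fin 2 × κ) ℂ →ₐ[ℂ] MvPolynomial (Fin 2 × κ) ℂ) where
  toFun g := MvPolynomial.aeval fun p => translated κ g p.1 p.2
  map_one' := by
    ext p : 1
    have e : scalarMatrix κ (1 : SL(2, ℂ))⁻¹ = 1 := by
      rw [scalarMatrix, inv_one, Matrix.SpecialLinearGroup.coe_one, map_one]
    rw [translated, e, Matrix.one_mul]
    simp [genM]
  map_mul' g h := by
    ext p : 1
    have e : ∀ k : SL(2, ℂ), translated κ k = scalarMatrix κ k⁻¹ * genM κ := fun _ => rfl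
    have hm : scalarMatrix κ (g * h)⁻¹ = scalarMatrix κ h⁻¹ * scalarMatrix κ g⁻¹ := by
      simp only [scalarMatrix, mul_inv_rev, Matrix.SpecialLinearGroup.coe_mul, map_mul]
    rw [MvPolynomial.aeval_X, e (g * h), hm, AlgHom.mul_apply, MvPolynomial.aeval_X, e h,
      Matrix.mul_assoc, ← e g, Matrix.mul_apply, Matrix.mul_apply, map_sum]
    refine Finset.sum_congr rfl fun k _ => ?_
    simp [scalarMatrix, genM, MvPolynomial.algHom_C]

/-- An action by algebra endomorphisms descends to the quotient by a stable ideal. -/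
def quotientAction {B : Type*} [CommRing B] [Algebra ℂ B] (ρ : SL(2, ℂ) →* (B →ₐ[ℂ] B))
    (I : Ideal B) (hI : ∀ g, I ≤ I.comap (ρ g)) : SL(2, ℂ) →* (B ⧸ I →ₐ[ℂ] B ⧸ I) where
  toFun g := Ideal.quotientMapₐ I (ρ g) (hI g)
  map_one' := by
    apply Ideal.Quotient.algHom_ext
    ext x
    simp
  map_mul' g h := by
    apply Ideal.Quotient.algHom_ext
    ext x
    simp

theorem polyAction_map (κ : Type) (g : SL(2, ℂ)) :
    (genM κ).map (polyAction κ g) = translated κ g := by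
  ext i j : 2
  simp [genM, polyAction]

theorem transpose_mul_formJ_mul {R : Type*} [CommRing R] (G : Matrix (Fin 2) (Fin 2) R)
    (hG : G.det = 1) : G.transpose * formJ R * G = formJ R := by
  rw [Matrix.det_fin_two] at hG
  ext i j
  fin_cases i <;> fin_cases j <;> simp [formJ, Matrix.mul_apply, Fin.sum_univ_two]
  · ring
  · linear_combination hG
  · linear_combination -hG
  · ring

theorem momentMap_mul {R : Type*} [CommRing R] (G : Matrix (Fin 2) (Fin 2) R)
    (hG : G.det = 1) (M : Matrix (Fin 2) Idx R) :
    momentMap (G * M) = G * momentMap M * G.adjugate := by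
  have h : G.transpose * formJ R = formJ R * G.adjugate := by
    calc G.transpose * formJ R = G.transpose * formJ R * (G * G.adjugate) := by
          rw [Matrix.mul_adjugate, hG, one_smul, Matrix.mul_one]
      _ = G.transpose * formJ R * G * G.adjugate := by simp only [Matrix.mul_assoc]
      _ = formJ R * G.adjugate := by rw [transpose_mul_formJ_mul G hG]
  simp only [momentMap, Matrix.transpose_mul, Matrix.mul_assoc, h]

theorem nuMap_mul {R : Type*} [CommRing R] (G : Matrix (Fin 2) (Fin 2) R)
    (hG : G.det = 1) (M : Matrix (Fin 2) Idx R) : nuMap (G * M) = nuMap M := by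
  have : nuMap (G * M) = M.transpose * (G.transpose * formJ R * G) * M * formQ R := by
    simp only [nuMap, Matrix.transpose_mul, Matrix.mul_assoc]
  rw [this, transpose_mul_formJ_mul G hG, nuMap]

theorem zeroFibreIdeal_stable (g : SL(2, ℂ)) :
    zeroFibreIdeal ≤ zeroFibreIdeal.comap (polyAction Idx g) := by
  refine Ideal.span_le.mpr ?_
  rintro _ ⟨p, rfl⟩
  have h : (momentMap (genM Idx)).map (polyAction Idx g).toRingHom =
      scalarMatrix Idx g⁻¹ * momentMap (genM Idx) * (scalarMatrix Idx g⁻¹).adjugate := by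
    rw [← momentMap_map, ← momentMap_mul _ (scalarMatrix_det Idx g⁻¹)]
    exact congrArg momentMap (polyAction_map Idx g)
  have h2 : polyAction Idx g (momentMap (genM Idx) p.1 p.2) =
      (scalarMatrix Idx g⁻¹ * momentMap (genM Idx) * (scalarMatrix Idx g⁻¹).adjugate) p.1 p.2 :=
    congrFun (congrFun h p.1) p.2
  change polyAction Idx g (momentMap (genM Idx) p.1 p.2) ∈ zeroFibreIdeal
  rw [h2, Matrix.mul_apply]
  refine Ideal.sum_mem _ fun k _ => Ideal.mul_mem_right _ _ ?_
  rw [Matrix.mul_apply]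
  exact Ideal.sum_mem _ fun l _ => Ideal.mul_mem_left _ _ (Ideal.subset_span ⟨(l, k), rfl⟩)

/-- The action of `SL₂(ℂ)` on `ℂ[μ⁻¹(0)]`. -/
def zeroFibreAction : SL(2, ℂ) →* (ZeroFibreRing →ₐ[ℂ] ZeroFibreRing) :=
  quotientAction (polyAction Idx) zeroFibreIdeal zeroFibreIdeal_stable

/-- The morphism `ν` is `SL₂`-invariant. -/
theorem zeroFibreAction_nuComorphism (g : SL(2, ℂ)) (s : OrbitClosureRing) :
    zeroFibreAction g (nuComorphism s) = nuComorphism s := by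
  have h : (zeroFibreAction g).comp nuComorphism = nuComorphism := by
    apply Ideal.Quotient.algHom_ext
    ext p : 1
    have e : ∀ p : Idx × Idx, nuComorphism (Ideal.Quotient.mk orbitClosureIdeal
        (MvPolynomial.X p)) = Ideal.Quotient.mk zeroFibreIdeal (nuMap (genM Idx) p.1 p.2) := by
      intro p
      change MvPolynomial.aeval _ (MvPolynomial.X p) = _
      rw [MvPolynomial.aeval_X, nuMap_map]
      rfl
    change zeroFibreAction g (nuComorphism (Ideal.Quotient.mk orbitClosureIdeal
      (MvPolynomial.X p))) = nuComorphism (Ideal.Quotient.mk orbitClosureIdeal (MvPolynomial.X p))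
    rw [e]
    have h1 : (nuMap (genM Idx)).map (polyAction Idx g).toRingHom = nuMap (genM Idx) := by
      rw [← nuMap_map, ← nuMap_mul _ (scalarMatrix_det Idx g⁻¹) (genM Idx)]
      exact congrArg nuMap (polyAction_map Idx g)
    have h2 : polyAction Idx g (nuMap (genM Idx) p.1 p.2) = nuMap (genM Idx) p.1 p.2 :=
      congrFun (congrFun h1 p.1) p.2
    change Ideal.Quotient.mk zeroFibreIdeal (polyAction Idx g (nuMap (genM Idx) p.1 p.2)) = _
    rw [h2]
  exact DFunLike.congr_fun h s

theorem fibreIdeal_stable (A : Matrix Idx Idx ℂ) (hA : A ∈ orbitClosure) (g : SL(2, ℂ)) :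
    fibreIdeal A hA ≤ (fibreIdeal A hA).comap (zeroFibreAction g) := by
  refine Ideal.map_le_iff_le_comap.mpr fun s hs => ?_
  simp only [Ideal.mem_comap]
  have h := zeroFibreAction_nuComorphism g s
  change zeroFibreAction g (nuComorphism s) ∈ _
  rw [h]
  exact Ideal.mem_map_of_mem nuComorphism.toRingHom hs

/-- The action of `SL₂(ℂ)` on the coordinate ring of the fibre `ν⁻¹(A)`. -/
def fibreAction (A : Matrix Idx Idx ℂ) (hA : A ∈ orbitClosure) :
    SL(2, ℂ) →* (FibreRing A hA →ₐ[ℂ] FibreRing A hA) :=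
  quotientAction zeroFibreAction (fibreIdeal A hA) (fibreIdeal_stable A hA)

/-- The coordinate ring of the fibre `ν⁻¹(A)` as a representation of `SL₂(ℂ)`. -/
def fibreRep (A : Matrix Idx Idx ℂ) (hA : A ∈ orbitClosure) :
    Representation ℂ SL(2, ℂ) (FibreRing A hA) :=
  (AlgHom.toEnd (R := ℂ) (A := FibreRing A hA)).comp (fibreAction A hA)

theorem detIdeal_stable (g : SL(2, ℂ)) :
    Ideal.span {(genM (Fin 2)).det - 1} ≤
      (Ideal.span {(genM (Fin 2)).det - 1}).comap (polyAction (Fin 2) g) := by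
  refine Ideal.span_le.mpr ?_
  rintro _ rfl
  have h : polyAction (Fin 2) g (genM (Fin 2)).det = (genM (Fin 2)).det := by
    have h1 : polyAction (Fin 2) g (genM (Fin 2)).det =
        ((genM (Fin 2)).map (polyAction (Fin 2) g)).det :=
      AlgHom.map_det (polyAction (Fin 2) g) (genM (Fin 2))
    rw [h1, polyAction_map, translated, Matrix.det_mul, scalarMatrix_det, one_mul]
  change polyAction (Fin 2) g ((genM (Fin 2)).det - 1) ∈
    Ideal.span {(genM (Fin 2)).det - 1}
  rw [map_sub, h, map_one]
  exact Ideal.subset_span rfl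

/-- The action of `SL₂(ℂ)` on `ℂ[SL₂]` induced by left multiplication. -/
def sl2Action : SL(2, ℂ) →* (SL2Ring →ₐ[ℂ] SL2Ring) :=
  quotientAction (polyAction (Fin 2)) _ detIdeal_stable

/-- The space `ℂ[x, y]_d` of binary forms of degree `d`: homogeneous polynomial functions of
degree `d` on column vectors with two entries. -/
abbrev BinaryForms (d : ℕ) : Submodule ℂ (MvPolynomial (Fin 2 × Unit) ℂ) :=
  MvPolynomial.homogeneousSubmodule (Fin 2 × Unit) ℂ d

theorem binaryForms_stable (d : ℕ) (g : SL(2, ℂ)) :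
    ∀ f ∈ BinaryForms d, (polyAction Unit g).toLinearMap f ∈ BinaryForms d := by
  intro f hf
  have h : ∀ p : Fin 2 × Unit, (translated Unit g p.1 p.2).IsHomogeneous 1 := by
    intro p
    rw [translated, Matrix.mul_apply]
    refine MvPolynomial.IsHomogeneous.sum _ _ _ fun k _ => ?_
    simpa [scalarMatrix, genM] using
      MvPolynomial.isHomogeneous_C_mul_X (R := ℂ) ((g⁻¹ : SL(2, ℂ)).1 p.1 k) (k, p.2)
  have h2 := MvPolynomial.IsHomogeneous.aeval (hφ := hf) _ h
  simpa [polyAction] using h2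

/-- The irreducible representation `V_d = ℂ[x, y]_d` of `SL₂(ℂ)`, of dimension `d + 1`. -/
def binaryFormsRep (d : ℕ) : Representation ℂ SL(2, ℂ) (BinaryForms d) where
  toFun g := (polyAction Unit g).toLinearMap.restrict (binaryForms_stable d g)
  map_one' := by
    ext f : 2
    simp
  map_mul' g h := by
    ext f : 2
    simp [LinearMap.restrict_apply]

/-- The multiplicity `dim Hom_{SL₂}(V_d, ℂ[ν⁻¹(A)])`, that is, the value at `d` of the Hilbert
function of the fibre `ν⁻¹(A)` (as a cardinal, so that infinite multiplicities are not hidden). -/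
def multiplicity (A : Matrix Idx Idx ℂ) (hA : A ∈ orbitClosure) (d : ℕ) : Cardinal :=
  Module.rank ℂ ((binaryFormsRep d).IntertwiningMap (fibreRep A hA))

end SymplecticReduction

end

/-!
The two rows of a `2 × 6` matrix `M` with `M Q Mᵗ = 0` span an isotropic plane, and the entries of
`A Q = Mᵗ J M` are its Plücker coordinates, the `2 × 2` minors of `M`. Where one such coordinate is
invertible, `M` can be recovered from `A` up to a unique element of `SL₂`: two columns of `M` may be
normalized, and then the others are read off from `A`. Hence `ν` is locally a trivial `SL₂`-bundle
over the orbit, so it is flat there with fibres `SL₂`.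

An isotropic plane with an invertible Plücker coordinate depends on six free parameters. The
localizations of the coordinate ring of the orbit closure away from `0` thus factor through
polynomial rings, which makes them reduced. The line `t ↦ t A₀` shows that the orbit is dense. A
complex isotropic plane in such a chart is spanned by two columns of an explicit isometry of
determinant `1`, so all nonzero complex points are conjugate. Finally, by Frobenius reciprocity,
evaluation at `1` identifies `Hom_{SL₂}(V_d, ℂ[SL₂])` with the dual of `V_d`.
-/

noncomputable section

namespace SymplecticReduction

/-! ### Plücker coordinates -/

/-- The entries of `A Q`. They are the coordinates of choice on the orbit closure: if `A = Mᵗ J M Q`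
then `A Q = Mᵗ J M` is the matrix of `2 × 2` minors of `M`. -/
def coord {R : Type*} (A : Matrix Idx Idx R) (i j : Idx) : R := A i j.swap

theorem coord_map {R S : Type*} (φ : R → S) (A : Matrix Idx Idx R) (i j : Idx) :
    coord (A.map φ) i j = φ (coord A i j) := rfl

theorem ext_coord {R : Type*} {A B : Matrix Idx Idx R}
    (h : ∀ i j, coord A i j = coord B i j) : A = B := by
  ext i j
  simpa only [coord, Sum.swap_swap] using h i j.swap

section Coordinates

variable {R κ : Type*} [CommRing R]

theorem mul_formQ_apply (M : Matrix κ Idx R) (i : κ) (j : Idx) :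
    (M * formQ R) i j = M i j.swap := by
  rcases j with j | j <;> simp [Matrix.mul_apply, formQ, Matrix.one_apply]

theorem formQ_mul_apply (M : Matrix Idx κ R) (i : Idx) (j : κ) :
    (formQ R * M) i j = M i.swap j := by
  rcases i with i | i <;> simp [Matrix.mul_apply, formQ, Matrix.one_apply]

theorem sum_swap (f : Idx → R) : ∑ k : Idx, f k.swap = ∑ k, f k :=
  (Equiv.sumComm (Fin 3) (Fin 3)).sum_comp f

theorem nuMap_apply (M : Matrix (Fin 2) Idx R) (i j : Idx) :
    nuMap M i j = M 0 i * M 1 j.swap - M 1 i * M 0 j.swap := by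
  rw [nuMap, mul_formQ_apply]
  simp only [formJ, Matrix.mul_apply, Fin.sum_univ_two, Matrix.transpose_apply, Matrix.of_apply,
    Matrix.cons_val_zero, Matrix.cons_val_one, Matrix.cons_val', Matrix.cons_val_fin_one]
  ring

theorem momentMap_eq_zero_iff {M : Matrix (Fin 2) Idx R} :
    momentMap M = 0 ↔ ∀ a b, ∑ k, M a k * M b k.swap = 0 := by
  have hJ : IsUnit (formJ R) := by
    simp [Matrix.isUnit_iff_isUnit_det, formJ, Matrix.det_fin_two]
  have entry (a b : Fin 2) : (M * formQ R * M.transpose) a b = ∑ k, M a k * M b k.swap := by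
    rw [Matrix.mul_apply, ← sum_swap]
    simp only [mul_formQ_apply, Matrix.transpose_apply, Sum.swap_swap]
  rw [momentMap, hJ.mul_left_eq_zero, ← Matrix.ext_iff]
  simp only [entry, Matrix.zero_apply]

theorem coord_nuMap (M : Matrix (Fin 2) Idx R) (i j : Idx) :
    coord (nuMap M) i j = M 0 i * M 1 j - M 1 i * M 0 j := by
  rw [coord, nuMap_apply, Sum.swap_swap]

end Coordinates

section ClosurePoints

variable {R S : Type*} [CommRing R] [CommRing S]

/-- The matrix `A` is an `R`-valued point of the orbit closure. -/
def IsClosurePoint (A : Matrix Idx Idx R) : Prop := ∀ f ∈ closureEquations A, f = 0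

theorem isClosurePoint_nuMap {M : Matrix (Fin 2) Idx R} (hM : momentMap M = 0) :
    IsClosurePoint (nuMap M) := closureEquations_nuMap M hM

theorem closureEquations_map_eq_image (φ : R →+* S) (A : Matrix Idx Idx R) :
    closureEquations (A.map φ) = φ '' closureEquations A := by
  refine Set.Subset.antisymm ?_ (Set.image_subset_iff.mpr fun f => closureEquations_map φ A)
  rintro f (((⟨p, rfl⟩ | ⟨p, rfl⟩) | ⟨p, rfl⟩) | ⟨p, rfl⟩)
  · refine ⟨_, Or.inl (Or.inl (Or.inl ⟨p, rfl⟩)), ?_⟩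
    simp only [Matrix.add_apply, mul_formQ_apply, formQ_mul_apply, Matrix.transpose_apply,
      Matrix.map_apply, map_add]
  · refine ⟨_, Or.inl (Or.inl (Or.inr ⟨p, rfl⟩)), ?_⟩
    simp only [Matrix.mul_apply, Matrix.map_apply, map_sum, map_mul]
  · refine ⟨_, Or.inl (Or.inr ⟨p, rfl⟩), ?_⟩
    simp only [RingHom.map_det, RingHom.mapMatrix_apply, Matrix.submatrix_map]
  · refine ⟨_, Or.inr ⟨p, rfl⟩, ?_⟩
    simp only [pf4, formQ_mul_apply, Matrix.map_apply, map_add, map_sub, map_mul]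

namespace IsClosurePoint

variable {A : Matrix Idx Idx R}

theorem map (hA : IsClosurePoint A) (φ : R →+* S) : IsClosurePoint (A.map φ) := by
  rw [IsClosurePoint, closureEquations_map_eq_image]
  rintro _ ⟨f, hf, rfl⟩
  rw [hA f hf, map_zero]

theorem coord_skew (hA : IsClosurePoint A) (i j : Idx) : coord A i j = -coord A j i := by
  have h := hA _ (Or.inl (Or.inl (Or.inl ⟨(j.swap, i.swap), rfl⟩)))
  simp only [Matrix.add_apply, mul_formQ_apply, formQ_mul_apply, Matrix.transpose_apply,
    Sum.swap_swap] at h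
  simp only [coord]
  linear_combination h

theorem coord_self (hA : IsClosurePoint A) (h2 : IsUnit (2 : R)) (i : Idx) : coord A i i = 0 :=
  h2.mul_right_eq_zero.mp (by linear_combination hA.coord_skew i i)

theorem coord_plucker (hA : IsClosurePoint A) (i j k l : Idx) :
    coord A i j * coord A k l = coord A i k * coord A j l - coord A i l * coord A j k := by
  have h := hA _ (Or.inr ⟨((i.swap, j.swap), (k.swap, l.swap)), rfl⟩)
  simp only [pf4, formQ_mul_apply, Sum.swap_swap] at h
  simp only [coord]
  linear_combination h

theorem coord_isotropic (hA : IsClosurePoint A) (i j : Idx) :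
    ∑ k, coord A i k * coord A j k.swap = 0 := by
  have h := hA _ (Or.inl (Or.inl (Or.inr ⟨(i, j.swap), rfl⟩)))
  simp only [Matrix.mul_apply] at h
  rw [← neg_eq_zero, ← h, ← sum_swap, ← Finset.sum_neg_distrib]
  refine Finset.sum_congr rfl fun k _ => ?_
  rw [hA.coord_skew j]
  simp only [coord, Sum.swap_swap, mul_neg, neg_neg]

end IsClosurePoint

end ClosurePoints

section SimplyTransitive

variable {R n κ : Type*} [CommRing R] [Fintype n] [DecidableEq n]

theorem adjugate_submatrix_mul_apply (M : Matrix n κ R) (c : n → κ) (a : n) (k : κ) :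
    ((M.submatrix id c).adjugate * M) a k =
      (M.submatrix id (Function.update c a k)).det := by
  have hcol : (M.submatrix id c).updateCol a (M.col k) =
      M.submatrix id (Function.update c a k) := by
    ext p q
    by_cases hq : q = a <;> simp [hq]
  rw [← hcol, ← Matrix.cramer_apply, Matrix.cramer_eq_adjugate_mulVec]
  rfl

theorem existsUnique_specialLinearGroup_mul_eq {M N : Matrix n κ R}
    (hdet : ∀ c : n → κ, (M.submatrix id c).det = (N.submatrix id c).det) {c : n → κ}
    (hu : IsUnit (N.submatrix id c).det) :
    ∃! G : Matrix.SpecialLinearGroup n R, (G : Matrix n n R) * N = M := by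
  have hinv : N.submatrix id c * (N.submatrix id c)⁻¹ = 1 := Matrix.mul_nonsing_inv _ hu
  refine ⟨⟨M.submatrix id c * (N.submatrix id c)⁻¹, ?_⟩, ?_, fun G hG => Subtype.ext ?_⟩
  · rw [Matrix.det_mul, hdet, ← Matrix.det_mul, hinv, Matrix.det_one]
  · have hadj : (N.submatrix id c).adjugate * N = (M.submatrix id c).adjugate * M := by
      ext a k
      rw [adjugate_submatrix_mul_apply, adjugate_submatrix_mul_apply, hdet]
    dsimp only
    rw [Matrix.inv_def, Matrix.mul_smul, Matrix.smul_mul, Matrix.mul_assoc, hadj,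
      ← Matrix.mul_assoc, Matrix.mul_adjugate, hdet, Matrix.smul_mul, Matrix.one_mul, smul_smul,
      Ring.inverse_mul_cancel _ hu, one_smul]
  · have hGc : (G : Matrix n n R) * N.submatrix id c = M.submatrix id c := by
      rw [← hG]; rfl
    dsimp only
    rw [← hGc, Matrix.mul_assoc, hinv, Matrix.mul_one]

end SimplyTransitive

section Sections

variable {R : Type*} [CommRing R]

theorem momentMap_mul_eq_zero {M : Matrix (Fin 2) Idx R} (hM : momentMap M = 0)
    {G : Matrix (Fin 2) (Fin 2) R} (hG : G.det = 1) : momentMap (G * M) = 0 := by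
  rw [momentMap_mul G hG, hM, Matrix.mul_zero, Matrix.zero_mul]

theorem det_submatrix_eq_coord_nuMap (M : Matrix (Fin 2) Idx R) (c : Fin 2 → Idx) :
    (M.submatrix id c).det = coord (nuMap M) (c 0) (c 1) := by
  rw [Matrix.det_fin_two, coord_nuMap]
  simp only [Matrix.submatrix_apply, id_eq]
  ring

theorem existsUnique_mul_eq_of_nuMap_eq {M N : Matrix (Fin 2) Idx R} (h : nuMap M = nuMap N)
    {i j : Idx} (hu : IsUnit (coord (nuMap N) i j)) :
    ∃! G : SL(2, R), (G : Matrix (Fin 2) (Fin 2) R) * N = M := by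
  refine existsUnique_specialLinearGroup_mul_eq (c := ![i, j]) (fun c => ?_) ?_
  · rw [det_submatrix_eq_coord_nuMap, det_submatrix_eq_coord_nuMap, h]
  · rwa [det_submatrix_eq_coord_nuMap]

/-- The preimage of `A` under `ν` whose columns `i`, `j` are `(1, 0)` and `(0, c)`, where
`c = coord A i j` has inverse `c'`. It is a section of `ν` over the open set where `coord i j` is
invertible. -/
def sectionMatrix (A : Matrix Idx Idx R) (i j : Idx) (c' : R) : Matrix (Fin 2) Idx R :=
  Matrix.of ![fun k => c' * coord A k j, fun k => coord A i k]

@[simp]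
theorem sectionMatrix_zero (A : Matrix Idx Idx R) (i j k : Idx) (c' : R) :
    sectionMatrix A i j c' 0 k = c' * coord A k j := rfl

@[simp]
theorem sectionMatrix_one (A : Matrix Idx Idx R) (i j k : Idx) (c' : R) :
    sectionMatrix A i j c' 1 k = coord A i k := rfl

theorem nuMap_sectionMatrix {A : Matrix Idx Idx R} (hA : IsClosurePoint A) {i j : Idx} {c' : R}
    (hc : c' * coord A i j = 1) : nuMap (sectionMatrix A i j c') = A := by
  refine ext_coord fun k l => ?_
  rw [coord_nuMap]
  simp only [sectionMatrix_zero, sectionMatrix_one]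
  linear_combination coord A k l * hc - c' * hA.coord_plucker i j k l +
    c' * coord A i l * hA.coord_skew k j - c' * coord A i k * hA.coord_skew l j

theorem momentMap_sectionMatrix {A : Matrix Idx Idx R} (hA : IsClosurePoint A) (i j : Idx)
    (c' : R) : momentMap (sectionMatrix A i j c') = 0 := by
  have multiple_of_coord (a : Fin 2) :
      ∃ r m, ∀ k, sectionMatrix A i j c' a k = r * coord A m k := by
    fin_cases a
    · exact ⟨-c', j, fun k => by simp [hA.coord_skew k j]⟩
    · exact ⟨1, i, fun k => by simp⟩
  refine momentMap_eq_zero_iff.mpr fun a b => ?_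
  obtain ⟨r, m, hr⟩ := multiple_of_coord a
  obtain ⟨s, l, hs⟩ := multiple_of_coord b
  simp only [hr, hs, mul_mul_mul_comm r _ s, ← Finset.mul_sum, hA.coord_isotropic, mul_zero]

end Sections

section AlgHomMaps

variable {k R S m n l : Type*}

theorem map_mul_algHom [CommSemiring k] [Semiring R] [Semiring S] [Algebra k R] [Algebra k S]
    [Fintype n] (φ : R →ₐ[k] S) (M : Matrix m n R) (N : Matrix n l R) :
    (M * N).map φ = M.map φ * N.map φ :=
  Matrix.map_mul (f := φ.toRingHom)

theorem map_algebraMap_map_algHom [CommSemiring k] [Semiring R] [Semiring S] [Algebra k R]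
    [Algebra k S] (φ : R →ₐ[k] S) (M : Matrix m n k) :
    (M.map (algebraMap k R)).map φ = M.map (algebraMap k S) := by
  ext i j
  exact φ.commutes _

variable [CommRing k] [CommRing R] [CommRing S] [Algebra k R] [Algebra k S]

theorem momentMap_map_algHom (φ : R →ₐ[k] S) (M : Matrix (Fin 2) Idx R) :
    momentMap (M.map φ) = (momentMap M).map φ :=
  momentMap_map φ.toRingHom M

theorem nuMap_map_algHom (φ : R →ₐ[k] S) (M : Matrix (Fin 2) Idx R) :
    nuMap (M.map φ) = (nuMap M).map φ :=
  nuMap_map φ.toRingHom M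

end AlgHomMaps

section UniversalPoints

variable {S : Type*} [CommRing S] [Algebra ℂ S]

theorem genM_map_aeval {κ : Type} (M : Matrix (Fin 2) κ S) :
    (genM κ).map (MvPolynomial.aeval (R := ℂ) fun p => M p.1 p.2) = M := by
  ext i j
  simp [genM]

theorem genA_map_aeval (A : Matrix Idx Idx S) :
    genA.map (MvPolynomial.aeval (R := ℂ) fun p => A p.1 p.2) = A := by
  ext i j
  simp [genA]

/-- The universal point of the zero fibre of the moment map. -/
def zeroFibreMatrix : Matrix (Fin 2) Idx ZeroFibreRing :=
  (genM Idx).map (Ideal.Quotient.mk zeroFibreIdeal)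

/-- The universal point of the orbit closure. -/
def orbitMatrix : Matrix Idx Idx OrbitClosureRing :=
  genA.map (Ideal.Quotient.mk orbitClosureIdeal)

/-- The universal point of `SL₂`. -/
def sl2Matrix : Matrix (Fin 2) (Fin 2) SL2Ring :=
  (genM (Fin 2)).map (Ideal.Quotient.mk (Ideal.span {(genM (Fin 2)).det - 1}))

theorem momentMap_zeroFibreMatrix : momentMap zeroFibreMatrix = 0 := momentMap_generic_eq_zero

theorem isClosurePoint_orbitMatrix : IsClosurePoint orbitMatrix := by
  rw [IsClosurePoint, orbitMatrix, closureEquations_map_eq_image]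
  rintro _ ⟨f, hf, rfl⟩
  exact Ideal.Quotient.eq_zero_iff_mem.mpr (Ideal.subset_span hf)

theorem det_sl2Matrix : sl2Matrix.det = 1 := by
  rw [sl2Matrix, ← RingHom.mapMatrix_apply, ← RingHom.map_det, ← sub_eq_zero,
    ← map_one (Ideal.Quotient.mk _), ← map_sub]
  exact Ideal.Quotient.eq_zero_iff_mem.mpr (Ideal.subset_span rfl)

theorem det_sl2Matrix_map (φ : SL2Ring →ₐ[ℂ] S) : (sl2Matrix.map φ).det = 1 := by
  rw [← AlgHom.mapMatrix_apply, ← AlgHom.map_det, det_sl2Matrix, map_one]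

/-- A solution `x` in `S` of the equations `E` as an `S`-valued point of the affine scheme they
define. -/
def pointOfSolution {σ : Type*} {E : Set (MvPolynomial σ ℂ)} (x : σ → S)
    (hx : ∀ f ∈ E, MvPolynomial.aeval x f = 0) : MvPolynomial σ ℂ ⧸ Ideal.span E →ₐ[ℂ] S :=
  Ideal.Quotient.liftₐ _ (MvPolynomial.aeval x) fun _ hf =>
    Ideal.span_le (I := RingHom.ker (MvPolynomial.aeval x)).mpr hx hf

/-- The `S`-valued point of the zero fibre of the moment map given by a matrix. -/
def zeroFibreLift (M : Matrix (Fin 2) Idx S) (hM : momentMap M = 0) : ZeroFibreRing →ₐ[ℂ] S :=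
  pointOfSolution (fun p => M p.1 p.2) (by
    rintro _ ⟨p, rfl⟩
    rw [← genM_map_aeval M, momentMap_map_algHom] at hM
    exact congrFun₂ hM p.1 p.2)

/-- The `S`-valued point of the orbit closure given by a matrix. -/
def orbitLift (A : Matrix Idx Idx S) (hA : IsClosurePoint A) : OrbitClosureRing →ₐ[ℂ] S :=
  pointOfSolution (fun p => A p.1 p.2) fun f hf => by
    rw [← genA_map_aeval A] at hA
    exact hA _ (closureEquations_map (AlgHom.toRingHom _) genA hf)

/-- The `S`-valued point of `SL₂` given by a matrix. -/
def sl2Lift (G : SL(2, S)) : SL2Ring →ₐ[ℂ] S :=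
  pointOfSolution (fun p => G.1 p.1 p.2) (by
    rintro _ rfl
    rw [map_sub, map_one, AlgHom.map_det, AlgHom.mapMatrix_apply, genM_map_aeval, G.2, sub_self])

@[simp]
theorem zeroFibreMatrix_map_lift (M : Matrix (Fin 2) Idx S) (hM : momentMap M = 0) :
    zeroFibreMatrix.map (zeroFibreLift M hM) = M :=
  genM_map_aeval M

@[simp]
theorem orbitMatrix_map_lift (A : Matrix Idx Idx S) (hA : IsClosurePoint A) :
    orbitMatrix.map (orbitLift A hA) = A :=
  genA_map_aeval A

@[simp]
theorem sl2Matrix_map_lift (G : SL(2, S)) : sl2Matrix.map (sl2Lift G) = G.1 :=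
  genM_map_aeval G.1

@[simp]
theorem orbitMatrix_map_evalAt (A : Matrix Idx Idx ℂ) (hA : A ∈ orbitClosure) :
    orbitMatrix.map (evalAt A hA) = A :=
  genA_map_aeval A

theorem zeroFibre_algHom_ext {f g : ZeroFibreRing →ₐ[ℂ] S}
    (h : zeroFibreMatrix.map f = zeroFibreMatrix.map g) : f = g := by
  apply Ideal.Quotient.algHom_ext
  ext p : 1
  exact congrFun₂ h p.1 p.2

theorem orbit_algHom_ext {f g : OrbitClosureRing →ₐ[ℂ] S}
    (h : orbitMatrix.map f = orbitMatrix.map g) : f = g := by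
  apply Ideal.Quotient.algHom_ext
  ext p : 1
  exact congrFun₂ h p.1 p.2

theorem sl2_algHom_ext {f g : SL2Ring →ₐ[ℂ] S} (h : sl2Matrix.map f = sl2Matrix.map g) :
    f = g := by
  apply Ideal.Quotient.algHom_ext
  ext p : 1
  exact congrFun₂ h p.1 p.2

theorem orbitMatrix_map_nuComorphism : orbitMatrix.map nuComorphism = nuMap zeroFibreMatrix :=
  genA_map_aeval (nuMap zeroFibreMatrix)

theorem orbitMatrix_map_comp_nuComorphism (f : ZeroFibreRing →ₐ[ℂ] S) :
    orbitMatrix.map (f.comp nuComorphism) = nuMap (zeroFibreMatrix.map f) := by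
  rw [nuMap_map_algHom, ← orbitMatrix_map_nuComorphism, Matrix.map_map, AlgHom.coe_comp]

theorem polyAction_X (κ : Type) (g : SL(2, ℂ)) (a : Fin 2) (j : κ) :
    polyAction κ g (MvPolynomial.X (a, j)) =
      ∑ b, algebraMap ℂ _ ((g⁻¹ : SL(2, ℂ)).1 a b) * MvPolynomial.X (b, j) := by
  rw [polyAction, MonoidHom.coe_mk, OneHom.coe_mk, MvPolynomial.aeval_X, translated,
    Matrix.mul_apply]
  rfl

theorem sl2Matrix_map_action (g : SL(2, ℂ)) :
    sl2Matrix.map (sl2Action g) = (g⁻¹ : SL(2, ℂ)).1.map (algebraMap ℂ SL2Ring) * sl2Matrix := by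
  ext i j
  exact (congrArg (Ideal.Quotient.mk _) (polyAction_X _ g i j)).trans (map_sum _ _ _)

theorem zeroFibreMatrix_map_action (g : SL(2, ℂ)) :
    zeroFibreMatrix.map (zeroFibreAction g) =
      (g⁻¹ : SL(2, ℂ)).1.map (algebraMap ℂ ZeroFibreRing) * zeroFibreMatrix := by
  ext i j
  exact (congrArg (Ideal.Quotient.mk _) (polyAction_X _ g i j)).trans (map_sum _ _ _)

end UniversalPoints

/-! ### Trivialization of `ν` over the orbit -/

section AlgebraPushouts

universe u v

variable {k : Type u} {A B C P P' : Type v} [CommRing k] [CommRing A] [CommRing B] [CommRing C]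
  [CommRing P] [CommRing P'] [Algebra k A] [Algebra k B] [Algebra k C] [Algebra k P] [Algebra k P']
  {f : A →ₐ[k] B} {g : A →ₐ[k] C} {inl : B →ₐ[k] P} {inr : C →ₐ[k] P}
  {inl' : B →ₐ[k] P'} {inr' : C →ₐ[k] P'}

theorem isPushout_ofHom_of_existsUnique (w : inl.comp f = inr.comp g)
    (h : ∀ (T : Type v) [CommRing T] [Algebra k T] (b : B →ₐ[k] T) (c : C →ₐ[k] T),
      b.comp f = c.comp g → ∃! t : P →ₐ[k] T, t.comp inl = b ∧ t.comp inr = c) :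
    IsPushout (CommAlgCat.ofHom f) (CommAlgCat.ofHom g) (CommAlgCat.ofHom inl)
      (CommAlgCat.ofHom inr) := by
  have existsUnique_desc (s : Limits.PushoutCocone (CommAlgCat.ofHom f) (CommAlgCat.ofHom g)) :=
    h s.pt s.inl.hom s.inr.hom (congrArg CommAlgCat.Hom.hom s.condition)
  refine ⟨⟨congrArg CommAlgCat.ofHom w⟩, ⟨Limits.PushoutCocone.IsColimit.mk _
    (fun s => CommAlgCat.ofHom (existsUnique_desc s).choose) (fun s => ?_) (fun s => ?_)
    (fun s t hl hr => ?_)⟩⟩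
  · exact CommAlgCat.hom_ext (existsUnique_desc s).choose_spec.1.1
  · exact CommAlgCat.hom_ext (existsUnique_desc s).choose_spec.1.2
  · exact CommAlgCat.hom_ext ((existsUnique_desc s).choose_spec.2 t.hom
      ⟨congrArg CommAlgCat.Hom.hom hl, congrArg CommAlgCat.Hom.hom hr⟩)

theorem exists_algEquiv_of_isPushout
    (h : IsPushout (CommAlgCat.ofHom f) (CommAlgCat.ofHom g) (CommAlgCat.ofHom inl)
      (CommAlgCat.ofHom inr))
    (h' : IsPushout (CommAlgCat.ofHom f) (CommAlgCat.ofHom g) (CommAlgCat.ofHom inl')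
      (CommAlgCat.ofHom inr')) :
    ∃ e : P ≃ₐ[k] P', (e : P →ₐ[k] P').comp inl = inl' ∧ (e : P →ₐ[k] P').comp inr = inr' :=
  ⟨CommAlgCat.algEquivOfIso (h.isoIsPushout _ _ h'),
    congrArg CommAlgCat.Hom.hom (h.inl_isoIsPushout_hom _ _ h'),
    congrArg CommAlgCat.Hom.hom (h.inr_isoIsPushout_hom _ _ h')⟩

end AlgebraPushouts

section FibresAndLocalizations

universe u v

theorem isPushout_quotient_map_ker {k A B : Type u} [CommRing k] [CommRing A]
    [CommRing B] [Algebra k A] [Algebra k B] (f : A →ₐ[k] B) (x : A →ₐ[k] k) :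
    IsPushout (CommAlgCat.ofHom f) (CommAlgCat.ofHom x)
      (CommAlgCat.ofHom (Ideal.Quotient.mkₐ k ((RingHom.ker x.toRingHom).map f.toRingHom)))
      (CommAlgCat.ofHom (Algebra.ofId k _)) := by
  refine isPushout_ofHom_of_existsUnique ?_ fun T _ _ b c hbc => ?_
  · ext a
    have hker : a - algebraMap k A (x a) ∈ RingHom.ker x.toRingHom := by
      change x (a - algebraMap k A (x a)) = 0
      rw [map_sub, AlgHom.commutes, Algebra.algebraMap_self_apply, sub_self]
    have h := Ideal.Quotient.eq_zero_iff_mem.mpr (Ideal.mem_map_of_mem f.toRingHom hker)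
    rw [map_sub, map_sub, sub_eq_zero] at h
    exact h.trans (congrArg _ (f.commutes _))
  · have hle : (RingHom.ker x.toRingHom).map f.toRingHom ≤ RingHom.ker b := by
      refine Ideal.map_le_iff_le_comap.mpr fun a (ha : x a = 0) => ?_
      change b.comp f a = 0
      rw [hbc, AlgHom.comp_apply, ha, map_zero]
    refine ⟨Ideal.Quotient.liftₐ _ b hle, ⟨?_, Subsingleton.elim _ _⟩, fun t ht => ?_⟩
    · exact Ideal.Quotient.liftₐ_comp _ _ _
    · refine Ideal.Quotient.algHom_ext _ (ht.1.trans ?_)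
      exact (Ideal.Quotient.liftₐ_comp _ _ _).symm

theorem isPushout_localizationAway {k : Type u} {R S : Type v} [CommRing k] [CommRing R]
    [CommRing S] [Algebra k R] [Algebra k S] (R' S' : Type v) [CommRing R'] [CommRing S']
    [Algebra k R'] [Algebra k S'] [Algebra R R'] [Algebra S S'] [IsScalarTower k R R']
    [IsScalarTower k S S'] (f : R →ₐ[k] S) (b : R) [IsLocalization.Away b R']
    [IsLocalization.Away (f b) S'] :
    IsPushout (CommAlgCat.ofHom f) (CommAlgCat.ofHom (Algebra.algHom k R R'))
      (CommAlgCat.ofHom (Algebra.algHom k S S'))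
      (CommAlgCat.ofHom (IsLocalization.Away.mapₐ R' S' f b)) := by
  have w : (Algebra.algHom k S S').comp f =
      (IsLocalization.Away.mapₐ R' S' f b).comp (Algebra.algHom k R R') := by
    ext x
    exact (IsLocalization.lift_eq _ x).symm
  refine isPushout_ofHom_of_existsUnique w fun T _ _ s c hsc => ?_
  have hunit : IsUnit (s (f b)) := by
    change IsUnit (s.comp f b)
    rw [hsc]
    exact (IsLocalization.Away.algebraMap_isUnit (S := R') b).map c
  let t : S' →ₐ[k] T := IsLocalization.liftAlgHom (M := Submonoid.powers (f b)) (f := s) (by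
    rintro ⟨_, n, rfl⟩
    simpa only [map_pow] using hunit.pow n)
  have ht : t.comp (Algebra.algHom k S S') = s :=
    AlgHom.ext fun a => IsLocalization.lift_eq _ a
  refine ⟨t, ⟨ht, ?_⟩, fun t' ht' => ?_⟩
  · refine IsLocalization.algHom_ext (Submonoid.powers b) ?_
    rw [AlgHom.comp_assoc, ← w, ← AlgHom.comp_assoc, ht, hsc]
  · exact IsLocalization.algHom_ext (Submonoid.powers (f b)) (ht'.1.trans ht.symm)

end FibresAndLocalizations

section Translates

variable {S T : Type*} [CommRing S] [CommRing T] [Algebra ℂ S] [Algebra ℂ T]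

/-- The action of `SL₂` on the zero fibre of the moment map, on `S`-valued points. -/
def translate (G : SL2Ring →ₐ[ℂ] S) (x : ZeroFibreRing →ₐ[ℂ] S) : ZeroFibreRing →ₐ[ℂ] S :=
  zeroFibreLift (sl2Matrix.map G * zeroFibreMatrix.map x) <| by
    refine momentMap_mul_eq_zero ?_ (det_sl2Matrix_map G)
    rw [momentMap_map_algHom, momentMap_zeroFibreMatrix, Matrix.map_zero _ (map_zero _)]

@[simp]
theorem zeroFibreMatrix_map_translate (G : SL2Ring →ₐ[ℂ] S) (x : ZeroFibreRing →ₐ[ℂ] S) :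
    zeroFibreMatrix.map (translate G x) = sl2Matrix.map G * zeroFibreMatrix.map x :=
  zeroFibreMatrix_map_lift _ _

theorem comp_translate (t : S →ₐ[ℂ] T) (G : SL2Ring →ₐ[ℂ] S) (x : ZeroFibreRing →ₐ[ℂ] S) :
    t.comp (translate G x) = translate (t.comp G) (t.comp x) := by
  refine zeroFibre_algHom_ext ?_
  simp only [zeroFibreMatrix_map_translate, AlgHom.coe_comp, ← Matrix.map_map, map_mul_algHom]

theorem translate_comp_nuComorphism (G : SL2Ring →ₐ[ℂ] S) (x : ZeroFibreRing →ₐ[ℂ] S) :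
    (translate G x).comp nuComorphism = x.comp nuComorphism := by
  refine orbit_algHom_ext ?_
  rw [orbitMatrix_map_comp_nuComorphism, orbitMatrix_map_comp_nuComorphism,
    zeroFibreMatrix_map_translate, nuMap_mul _ (det_sl2Matrix_map G)]

theorem existsUnique_translate_eq {x y : ZeroFibreRing →ₐ[ℂ] S}
    (h : y.comp nuComorphism = x.comp nuComorphism) {i j : Idx}
    (hu : IsUnit (x (nuComorphism (coord orbitMatrix i j)))) :
    ∃! G : SL2Ring →ₐ[ℂ] S, translate G x = y := by
  have hν : nuMap (zeroFibreMatrix.map y) = nuMap (zeroFibreMatrix.map x) := by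
    rw [← orbitMatrix_map_comp_nuComorphism, h, orbitMatrix_map_comp_nuComorphism]
  obtain ⟨G, hG, hunique⟩ := existsUnique_mul_eq_of_nuMap_eq hν (i := i) (j := j) (by
    rw [← orbitMatrix_map_comp_nuComorphism]
    exact hu)
  refine ⟨sl2Lift G, zeroFibre_algHom_ext ?_, fun G' hG' => sl2_algHom_ext ?_⟩
  · rw [zeroFibreMatrix_map_translate, sl2Matrix_map_lift, hG]
  · rw [sl2Matrix_map_lift, ← hunique ⟨_, det_sl2Matrix_map G'⟩ (by
      rw [← hG', zeroFibreMatrix_map_translate])]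

theorem exists_comp_nuComorphism_eq {x : OrbitClosureRing →ₐ[ℂ] S} {i j : Idx}
    (hu : IsUnit (x (coord orbitMatrix i j))) :
    ∃ s : ZeroFibreRing →ₐ[ℂ] S, s.comp nuComorphism = x := by
  obtain ⟨c', hc'⟩ := hu.exists_left_inv
  have hx := isClosurePoint_orbitMatrix.map x.toRingHom
  refine ⟨zeroFibreLift _ (momentMap_sectionMatrix hx i j c'), orbit_algHom_ext ?_⟩
  rw [orbitMatrix_map_comp_nuComorphism, zeroFibreMatrix_map_lift]
  exact nuMap_sectionMatrix hx hc'

end Translates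

section OrbitMap

open scoped TensorProduct

variable {T : Type} [CommRing T] [Algebra ℂ T]

/-- The map `(t, G) ↦ G * s(t)` from `Spec T × SL₂` to the zero fibre of the moment map, for a
`T`-valued point `s` of the latter. -/
def orbitMap (s : ZeroFibreRing →ₐ[ℂ] T) : ZeroFibreRing →ₐ[ℂ] T ⊗[ℂ] SL2Ring :=
  translate (S := T ⊗[ℂ] SL2Ring) Algebra.TensorProduct.includeRight
    ((Algebra.TensorProduct.includeLeft (S := ℂ)).comp s)

theorem comp_orbitMap {W : Type*} [CommRing W] [Algebra ℂ W] (t : T ⊗[ℂ] SL2Ring →ₐ[ℂ] W)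
    (s : ZeroFibreRing →ₐ[ℂ] T) :
    t.comp (orbitMap s) = translate (t.comp Algebra.TensorProduct.includeRight)
      ((t.comp Algebra.TensorProduct.includeLeft).comp s) :=
  comp_translate (S := T ⊗[ℂ] SL2Ring) t _ _

theorem isPushout_orbitMap {s : ZeroFibreRing →ₐ[ℂ] T} {i j : Idx}
    (hu : IsUnit (s (nuComorphism (coord orbitMatrix i j)))) :
    IsPushout (CommAlgCat.ofHom nuComorphism) (CommAlgCat.ofHom (s.comp nuComorphism))
      (CommAlgCat.ofHom (orbitMap s))
      (CommAlgCat.ofHom (Y := T ⊗[ℂ] SL2Ring) (Algebra.TensorProduct.includeLeft (S := ℂ))) := by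
  refine isPushout_ofHom_of_existsUnique ?_ fun W _ _ b c hbc => ?_
  · exact translate_comp_nuComorphism (S := T ⊗[ℂ] SL2Ring) _ _
  · obtain ⟨G, hG, hunique⟩ := existsUnique_translate_eq (x := c.comp s) hbc (hu.map c)
    refine ⟨Algebra.TensorProduct.productMap c G, ⟨?_, ?_⟩, fun t ht => ?_⟩
    · rw [comp_orbitMap, Algebra.TensorProduct.productMap_right,
        Algebra.TensorProduct.productMap_left, hG]
    · exact Algebra.TensorProduct.productMap_left _ _
    · have hG' : t.comp Algebra.TensorProduct.includeRight = G :=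
        hunique _ (by rw [← ht.1, ← ht.2, comp_orbitMap])
      exact Algebra.TensorProduct.ext
        (ht.2.trans (Algebra.TensorProduct.productMap_left _ _).symm)
        (hG'.trans (Algebra.TensorProduct.productMap_right _ _).symm)

end OrbitMap

section FibresOverTheOrbit

open scoped TensorProduct

/-- The orbit map `G ↦ G * s` from `SL₂` to the zero fibre of the moment map, for a complex point
`s` of the latter. -/
def pointOrbitMap (s : ZeroFibreRing →ₐ[ℂ] ℂ) : ZeroFibreRing →ₐ[ℂ] SL2Ring :=
  translate (AlgHom.id ℂ SL2Ring) ((Algebra.ofId ℂ SL2Ring).comp s)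

theorem pointOrbitMap_comp_zeroFibreAction (s : ZeroFibreRing →ₐ[ℂ] ℂ) (g : SL(2, ℂ)) :
    (pointOrbitMap s).comp (zeroFibreAction g) = (sl2Action g).comp (pointOrbitMap s) := by
  refine zeroFibre_algHom_ext ?_
  have hofId : (sl2Action g).comp ((Algebra.ofId ℂ SL2Ring).comp s) =
      (Algebra.ofId ℂ SL2Ring).comp s := by
    rw [← AlgHom.comp_assoc, Subsingleton.elim ((sl2Action g).comp (Algebra.ofId ℂ SL2Ring))]
  rw [AlgHom.coe_comp, ← Matrix.map_map, zeroFibreMatrix_map_action, map_mul_algHom,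
    map_algebraMap_map_algHom, pointOrbitMap, comp_translate, zeroFibreMatrix_map_translate,
    zeroFibreMatrix_map_translate, hofId, AlgHom.comp_id, sl2Matrix_map_action, Matrix.mul_assoc]
  simp only [AlgHom.coe_id, Matrix.map_id]

theorem lid_comp_orbitMap (s : ZeroFibreRing →ₐ[ℂ] ℂ) :
    (Algebra.TensorProduct.lid ℂ SL2Ring : ℂ ⊗[ℂ] SL2Ring →ₐ[ℂ] SL2Ring).comp (orbitMap s) =
      pointOrbitMap s := by
  rw [comp_orbitMap, pointOrbitMap]
  congr 1
  · ext x : 1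
    simp
  · rw [Subsingleton.elim (AlgHom.comp _ Algebra.TensorProduct.includeLeft)]

theorem coord_evalAt (A : Matrix Idx Idx ℂ) (hA : A ∈ orbitClosure) (i j : Idx) :
    evalAt A hA (coord orbitMatrix i j) = coord A i j := by
  rw [← coord_map (evalAt A hA), orbitMatrix_map_evalAt]

theorem exists_coord_ne_zero {R : Type*} [Zero R] {A : Matrix Idx Idx R} (hA : A ≠ 0) :
    ∃ i j, coord A i j ≠ 0 := by
  by_contra! h
  exact hA (ext_coord h)

theorem exists_algEquiv_sl2Ring {A : Matrix Idx Idx ℂ} (hA : A ∈ orbitClosure) (hA0 : A ≠ 0) :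
    ∃ e : FibreRing A hA ≃ₐ[ℂ] SL2Ring,
      ∀ g f, e (fibreAction A hA g f) = sl2Action g (e f) := by
  obtain ⟨i, j, hij⟩ := exists_coord_ne_zero hA0
  have hu : IsUnit (evalAt A hA (coord orbitMatrix i j)) := by
    rwa [coord_evalAt, isUnit_iff_ne_zero]
  obtain ⟨s, hs⟩ := exists_comp_nuComorphism_eq hu
  have hfibre := isPushout_quotient_map_ker nuComorphism (evalAt A hA)
  have horbit := isPushout_orbitMap (s := s) (by rwa [← hs] at hu)
  rw [hs] at horbit
  obtain ⟨e, he, -⟩ := exists_algEquiv_of_isPushout hfibre horbit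
  let e' : FibreRing A hA ≃ₐ[ℂ] SL2Ring := e.trans (Algebra.TensorProduct.lid ℂ SL2Ring)
  have he' (f : ZeroFibreRing) : e' (Ideal.Quotient.mk _ f) = pointOrbitMap s f := by
    rw [← lid_comp_orbitMap, ← he]
    rfl
  refine ⟨e', fun g f => ?_⟩
  obtain ⟨f, rfl⟩ := Ideal.Quotient.mk_surjective f
  rw [he', ← AlgHom.comp_apply, ← pointOrbitMap_comp_zeroFibreAction, AlgHom.comp_apply, ← he']
  rfl

end FibresOverTheOrbit

section Flatness

open scoped TensorProduct

theorem flat_awayMap_coord (i j : Idx) :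
    RingHom.Flat (R := Localization.Away (coord orbitMatrix i j))
      (S := Localization.Away (nuComorphism (coord orbitMatrix i j)))
      (Localization.awayMap nuComorphism.toRingHom (coord orbitMatrix i j)) := by
  let b : OrbitClosureRing := coord orbitMatrix i j
  let ι := Algebra.algHom ℂ OrbitClosureRing (Localization.Away b)
  have hu : IsUnit (ι b) := IsLocalization.Away.algebraMap_isUnit b
  obtain ⟨s, hs⟩ := exists_comp_nuComorphism_eq (x := ι) hu
  have hlocal := isPushout_localizationAway (Localization.Away b)
    (Localization.Away (nuComorphism b)) nuComorphism b
  have horbit := isPushout_orbitMap (s := s) (by rwa [← hs] at hu)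
  rw [hs] at horbit
  obtain ⟨e, -, he⟩ := exists_algEquiv_of_isPushout horbit hlocal
  have hflat : (algebraMap (Localization.Away b) (Localization.Away b ⊗[ℂ] SL2Ring)).Flat :=
    RingHom.flat_algebraMap_iff.mpr inferInstance
  have hcomp : e.toRingEquiv.toRingHom.comp (algebraMap _ _) =
    Localization.awayMap nuComorphism.toRingHom b := congrArg AlgHom.toRingHom he
  exact hcomp ▸ hflat.comp (.of_bijective e.bijective)

theorem flat_morphismRestrict_of_basicOpen {R S : CommRingCat} (f : R ⟶ S) (U : (Spec R).Opens)
    (H : ∀ x ∈ U, ∃ r : R, x ∈ PrimeSpectrum.basicOpen r ∧ PrimeSpectrum.basicOpen r ≤ U ∧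
      (Localization.awayMap f.hom r).Flat) : Flat (Spec.map f ∣_ U) := by
  have hlocal : IsZariskiLocalAtTarget @Flat :=
    HasRingHomProperty.instIsZariskiLocalAtTarget (P := @Flat) (Q := RingHom.Flat)
  have hiso : MorphismProperty.RespectsIso @Flat := hlocal.toRespects
  refine IsZariskiLocalAtTarget.of_forall_exists_morphismRestrict fun x => ?_
  obtain ⟨r, hx, hr, hflat⟩ := H x.1 x.2
  let D : (Spec R).Opens := PrimeSpectrum.basicOpen r
  have hD : U.ι ''ᵁ (U.ι ⁻¹ᵁ D) = D := by
    rw [Scheme.Hom.image_preimage_eq_opensRange_inf, Scheme.Opens.opensRange_ι]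
    exact inf_eq_right.mpr hr
  refine ⟨U.ι ⁻¹ᵁ D, hx, ?_⟩
  rw [MorphismProperty.arrow_mk_iso_iff (P := @Flat)
    (morphismRestrictRestrict _ _ _ ≪≫ morphismRestrictEq _ hD ≪≫ SpecMapRestrictBasicOpenIso f r)]
  exact Flat.SpecMap_iff.mpr hflat

end Flatness

/-! ### Charts on the orbit -/

section Permutations

variable {R κ : Type*} [CommRing R]

theorem momentMap_submatrix {σ : Equiv.Perm Idx} (hσ : Function.Commute σ Sum.swap)
    {M : Matrix (Fin 2) Idx R} (hM : momentMap M = 0) : momentMap (M.submatrix id σ) = 0 := by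
  refine momentMap_eq_zero_iff.mpr fun a b => ?_
  have h := momentMap_eq_zero_iff.mp hM a b
  rw [← Equiv.sum_comp σ] at h
  simpa only [Matrix.submatrix_apply, id_eq, hσ.eq] using h

theorem commute_symm {α : Type*} {σ : Equiv.Perm α} {f : α → α} (hσ : Function.Commute σ f) :
    Function.Commute σ.symm f :=
  Function.Commute.symm (hσ.symm.inverses_right σ.apply_symm_apply σ.symm_apply_apply)

theorem exists_injective_of_isotropic : ∀ i j : Idx, j ≠ i → j ≠ i.swap →
    ∃ k : Idx, Function.Injective
      (Sum.elim ![i, j, k] (fun a => (![i, j, k] a).swap) : Idx → Idx) := by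
  decide +kernel

theorem exists_even_perm_commute_swap {i j : Idx} (hji : j ≠ i) (hji' : j ≠ i.swap) :
    ∃ σ : Equiv.Perm Idx, Function.Commute σ Sum.swap ∧ Equiv.Perm.sign σ = 1 ∧
      σ (Sum.inl 0) = i ∧ σ (Sum.inl 1) = j := by
  obtain ⟨k, hk⟩ := exists_injective_of_isotropic i j hji hji'
  let σ : Equiv.Perm Idx := Equiv.ofBijective _ (Finite.injective_iff_bijective.mp hk)
  have hσ : Function.Commute σ Sum.swap := by
    rintro (s | s)
    · rfl
    · exact (Sum.swap_swap _).symm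
  rcases Int.units_eq_one_or (Equiv.Perm.sign σ) with hs | hs
  · exact ⟨σ, hσ, hs, rfl, rfl⟩
  · let τ : Equiv.Perm Idx := Equiv.swap (Sum.inl 2) (Sum.inr 2)
    have hτ : Function.Commute τ Sum.swap := by unfold Function.Commute Function.Semiconj; decide
    refine ⟨σ * τ, hσ.comp_left hτ, ?_, rfl, rfl⟩
    rw [map_mul, hs, Equiv.Perm.sign_swap (by decide), neg_mul_neg, one_mul]

end Permutations

section Chart

variable {R S : Type*} [CommRing R] [CommRing S]

/-- The parametrization, by an affine space, of the matrices `M` with `M Q Mᵗ = 0` whose first two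
columns form the matrix `diag(1, x₀)`. For invertible `x₀` every such matrix is obtained. -/
def chartMatrix (x : Fin 6 → R) : Matrix (Fin 2) Idx R :=
  Matrix.of ![Sum.elim ![1, 0, x 1] ![-(x 1 * x 2), x 3, x 2],
    Sum.elim ![0, x 0, x 0 * x 4]
      ![-(x 0 * (x 3 + x 1 * x 5 + x 2 * x 4)), -(x 0 * (x 4 * x 5)), x 0 * x 5]]

theorem chartMatrix_map (φ : R →+* S) (x : Fin 6 → R) :
    (chartMatrix x).map φ = chartMatrix fun i => φ (x i) := by
  ext a k
  fin_cases a <;> rcases k with k | k <;> fin_cases k <;> simp [chartMatrix]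

theorem momentMap_chartMatrix (x : Fin 6 → R) : momentMap (chartMatrix x) = 0 := by
  refine momentMap_eq_zero_iff.mpr fun a b => ?_
  rw [Fintype.sum_sum_type, Fin.sum_univ_three, Fin.sum_univ_three]
  fin_cases a <;> fin_cases b <;> simp [chartMatrix] <;> ring

theorem exists_chartMatrix_eq (h2 : IsUnit (2 : R)) {M : Matrix (Fin 2) Idx R}
    (hM : momentMap M = 0) (h00 : M 0 (.inl 0) = 1) (h01 : M 0 (.inl 1) = 0)
    (h10 : M 1 (.inl 0) = 0) {b' : R} (hb : b' * M 1 (.inl 1) = 1) :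
    ∃ x : Fin 6 → R, x 0 = M 1 (.inl 1) ∧ chartMatrix x = M := by
  have isotropy := momentMap_eq_zero_iff.mp hM
  simp only [Fintype.sum_sum_type, Fin.sum_univ_three, Sum.swap_inl, Sum.swap_inr] at isotropy
  have e01 := isotropy 0 1
  rw [h00, h01, h10] at e01
  have e00 : M 0 (.inr 0) + M 0 (.inl 2) * M 0 (.inr 2) = 0 := h2.mul_right_eq_zero.mp (by
    linear_combination isotropy 0 0 - 2 * M 0 (.inr 0) * h00 - 2 * M 0 (.inr 1) * h01)
  have e11 : M 1 (.inl 1) * M 1 (.inr 1) + M 1 (.inl 2) * M 1 (.inr 2) = 0 :=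
    h2.mul_right_eq_zero.mp (by linear_combination isotropy 1 1 - 2 * M 1 (.inr 0) * h10)
  refine ⟨![M 1 (.inl 1), M 0 (.inl 2), M 0 (.inr 2), M 0 (.inr 1), b' * M 1 (.inl 2),
    b' * M 1 (.inr 2)], rfl, Eq.symm ?_⟩
  ext a k
  fin_cases a <;> rcases k with k | k <;> fin_cases k <;>
    simp only [chartMatrix, Fin.zero_eta, Fin.mk_one, Fin.reduceFinMk, Matrix.of_apply,
      Matrix.cons_val, Sum.elim_inl, Sum.elim_inr]
  · exact h00
  · exact h01
  · linear_combination e00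
  · exact h10
  · linear_combination -M 1 (.inl 2) * hb
  · linear_combination e01 + (M 0 (.inl 2) * M 1 (.inr 2) +
      M 0 (.inr 2) * M 1 (.inl 2)) * hb
  · linear_combination b' * e11 - (M 1 (.inr 1) -
      b' * M 1 (.inl 2) * M 1 (.inr 2)) * hb
  · linear_combination -M 1 (.inr 2) * hb

theorem IsClosurePoint.exists_eq_nuMap_chartMatrix (h2 : IsUnit (2 : R)) {A : Matrix Idx Idx R}
    (hA : IsClosurePoint A) {σ : Equiv.Perm Idx} (hσ : Function.Commute σ Sum.swap)
    (hu : IsUnit (coord A (σ (.inl 0)) (σ (.inl 1)))) :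
    ∃ x : Fin 6 → R, x 0 = coord A (σ (.inl 0)) (σ (.inl 1)) ∧
      nuMap ((chartMatrix x).submatrix id σ.symm) = A := by
  obtain ⟨c', hc⟩ := hu.exists_left_inv
  let M := sectionMatrix A (σ (.inl 0)) (σ (.inl 1)) c'
  have hM : momentMap (M.submatrix id σ) = 0 :=
    momentMap_submatrix hσ (momentMap_sectionMatrix hA _ _ c')
  obtain ⟨x, hx0, hx⟩ := exists_chartMatrix_eq h2 hM hc (by simp [M, hA.coord_self h2])
    (by simp [M, hA.coord_self h2]) hc
  refine ⟨x, hx0, ?_⟩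
  rw [hx, Matrix.submatrix_submatrix, Equiv.self_comp_symm]
  exact nuMap_sectionMatrix hA hc

end Chart

theorem IsClosurePoint.exists_isotropic_coord_notMem {R : Type*} [CommRing R]
    (h2 : IsUnit (2 : R)) {A : Matrix Idx Idx R} (hA : IsClosurePoint A) (I : Ideal R)
    [hI : I.IsPrime] (h : ∃ i j, coord A i j ∉ I) :
    ∃ i j, j ≠ i ∧ j ≠ i.swap ∧ coord A i j ∉ I := by
  by_contra! H
  obtain ⟨i, j, hij⟩ := h
  have self_mem (k : Idx) : coord A k k ∈ I := by
    rw [hA.coord_self h2]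
    exact I.zero_mem
  have hji : j ≠ i := by
    rintro rfl
    exact hij (self_mem j)
  obtain rfl : j = i.swap := not_imp_comm.mp (H i j hji) hij
  -- the isotropy relation of the rows `i` and `i.swap` expresses `(coord A i i.swap) ^ 2`
  -- through isotropic coordinates
  have hs := hA.coord_isotropic i i.swap
  rw [← Finset.add_sum_erase _ _ (Finset.mem_univ i.swap), Sum.swap_swap, hA.coord_skew i.swap i,
    mul_neg, neg_add_eq_zero] at hs
  have hsq : coord A i i.swap * coord A i i.swap ∈ I := by
    rw [hs]
    refine Ideal.sum_mem _ fun k hk => Ideal.mul_mem_right _ _ ?_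
    by_cases hki : k = i
    · exact hki ▸ self_mem k
    · exact H i k hki (Finset.ne_of_mem_erase hk)
  exact hij (or_self_iff.mp (hI.mem_or_mem hsq))

theorem isUnit_two_of_complexAlgebra (S : Type*) [CommRing S] [Algebra ℂ S] : IsUnit (2 : S) := by
  simpa only [map_ofNat] using (IsUnit.mk0 (2 : ℂ) two_ne_zero).map (algebraMap ℂ S)

/-! ### The complex points of the orbit -/

section Isometry

variable {R : Type*} [CommRing R]

theorem formQ_mul_formQ : formQ R * formQ R = 1 := by
  simp [formQ, Matrix.fromBlocks_multiply]

/-- An isometry of `Q` with determinant `1` whose first two columns are the rows of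
`chartMatrix x`, for a left inverse `c'` of `x 0`. -/
def isometryMatrix (x : Fin 6 → R) (c' : R) : Matrix Idx Idx R :=
  Matrix.fromBlocks !![1, 0, 0; 0, x 0, 0; x 1, x 0 * x 4, 1] 0
    !![-(x 1 * x 2), -(x 0 * (x 3 + x 1 * x 5 + x 2 * x 4)), -x 2;
      x 3, -(x 0 * (x 4 * x 5)), -x 5;
      x 2, x 0 * x 5, 0]
    !![1, 0, -x 1; 0, c', -x 4; 0, 0, 1]

variable {x : Fin 6 → R} {c' : R}

theorem det_isometryMatrix (hc : c' * x 0 = 1) : (isometryMatrix x c').det = 1 := by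
  rw [isometryMatrix, Matrix.det_fromBlocks_zero₁₂, Matrix.det_fin_three, Matrix.det_fin_three]
  simpa [mul_comm] using hc

theorem isometryMatrix_gram (hc : c' * x 0 = 1) :
    (isometryMatrix x c').transpose * formQ R * isometryMatrix x c' = formQ R := by
  simp only [isometryMatrix, formQ, Matrix.fromBlocks_transpose, Matrix.fromBlocks_multiply]
  congr 1 <;> ext a b <;> fin_cases a <;> fin_cases b <;>
    simp [Matrix.mul_apply, Fin.sum_univ_three] <;> grind

theorem isometryMatrix_submatrix_transpose (x : Fin 6 → R) (c' : R) :
    (isometryMatrix x c').transpose.submatrix ![.inl 0, .inl 1] id = chartMatrix x := by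
  ext a k
  fin_cases a <;> rcases k with k | k <;> fin_cases k <;> rfl

theorem transpose_mul_formQ_mul_apply (g : Matrix Idx Idx R) (k l : Idx) :
    (g.transpose * formQ R * g) k l = ∑ i, g i k * g i.swap l := by
  rw [Matrix.mul_assoc, Matrix.mul_apply]
  simp only [formQ_mul_apply, Matrix.transpose_apply]

theorem gram_submatrix {σ : Equiv.Perm Idx} (hσ : Function.Commute σ Sum.swap)
    (g : Matrix Idx Idx R) :
    (g.submatrix σ id).transpose * formQ R * g.submatrix σ id = g.transpose * formQ R * g := by
  ext k l
  rw [transpose_mul_formQ_mul_apply, transpose_mul_formQ_mul_apply,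
    ← Equiv.sum_comp σ fun i => g i k * g i.swap l]
  simp only [Matrix.submatrix_apply, id_eq, hσ.eq]

theorem momentMap_rows_of_gram {g : Matrix Idx Idx R}
    (hg : g.transpose * formQ R * g = formQ R) :
    momentMap (g.transpose.submatrix ![.inl 0, .inl 1] id) = 0 := by
  have entry (k l : Idx) : ∑ i, g i k * g i.swap l = formQ R k l := by
    rw [← hg, transpose_mul_formQ_mul_apply]
  refine momentMap_eq_zero_iff.mpr fun a b => (entry _ _).trans ?_
  fin_cases a <;> fin_cases b <;> rfl

end Isometry

section Orbit

theorem nuMap_one_submatrix :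
    nuMap ((1 : Matrix Idx Idx ℂ).submatrix ![.inl 0, .inl 1] id) = basePoint := by
  ext k l
  rw [nuMap_apply]
  rcases k with k | k <;> rcases l with l | l <;> fin_cases k <;> fin_cases l <;>
    simp [basePoint, Matrix.one_apply]

theorem conj_basePoint {g : Matrix Idx Idx ℂ} (hg : g.transpose * formQ ℂ * g = formQ ℂ) :
    g * basePoint * g⁻¹ = nuMap (g.transpose.submatrix ![.inl 0, .inl 1] id) := by
  have hinv : g⁻¹ = formQ ℂ * g.transpose * formQ ℂ := by
    refine Matrix.inv_eq_left_inv ?_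
    rw [Matrix.mul_assoc, Matrix.mul_assoc, ← Matrix.mul_assoc g.transpose, hg, formQ_mul_formQ]
  have hrows : g.transpose.submatrix ![.inl 0, .inl 1] id =
      (1 : Matrix Idx Idx ℂ).submatrix ![.inl 0, .inl 1] id * g.transpose :=
    (Matrix.one_submatrix_mul _ (Equiv.refl Idx) _).symm
  rw [hinv, hrows, ← nuMap_one_submatrix, nuMap, nuMap, Matrix.transpose_mul,
    Matrix.transpose_transpose]
  simp only [Matrix.mul_assoc, ← Matrix.mul_assoc (formQ ℂ) (formQ ℂ), formQ_mul_formQ,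
    Matrix.one_mul]

theorem nilpotentOrbit_subset : nilpotentOrbit ⊆ orbitClosure := by
  rintro A ⟨g, hg, -, rfl⟩
  rw [conj_basePoint hg]
  exact isClosurePoint_nuMap (momentMap_rows_of_gram hg)

theorem zero_mem_orbitClosure : (0 : Matrix Idx Idx ℂ) ∈ orbitClosure := by
  have h : IsClosurePoint (nuMap (0 : Matrix (Fin 2) Idx ℂ)) :=
    isClosurePoint_nuMap (by simp [momentMap])
  rwa [nuMap, Matrix.mul_zero, Matrix.zero_mul] at h

theorem zero_notMem_nilpotentOrbit : (0 : Matrix Idx Idx ℂ) ∉ nilpotentOrbit := by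
  rintro ⟨g, -, hdet, h⟩
  have hu : IsUnit g := by
    rw [Matrix.isUnit_iff_isUnit_det, hdet]
    exact isUnit_one
  have h0 : basePoint = 0 := by
    rwa [eq_comm, (Matrix.isUnit_nonsing_inv_iff.mpr hu).mul_left_eq_zero,
      hu.mul_right_eq_zero] at h
  have h1 := congrFun₂ h0 (Sum.inl 0) (Sum.inr 1)
  simp [basePoint] at h1

theorem mem_nilpotentOrbit {A : Matrix Idx Idx ℂ} (hA : A ∈ orbitClosure) (hA0 : A ≠ 0) :
    A ∈ nilpotentOrbit := by
  have h2 := isUnit_two_of_complexAlgebra ℂ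
  have hclosure : IsClosurePoint A := hA
  obtain ⟨i, j, hji, hji', hij⟩ :=
    hclosure.exists_isotropic_coord_notMem h2 ⊥ (exists_coord_ne_zero hA0)
  obtain ⟨σ, hσ, hsign, rfl, rfl⟩ := exists_even_perm_commute_swap hji hji'
  obtain ⟨x, hx0, hx⟩ := hclosure.exists_eq_nuMap_chartMatrix h2 hσ (IsUnit.mk0 _ hij)
  have hc : (x 0)⁻¹ * x 0 = 1 := inv_mul_cancel₀ (hx0 ▸ hij)
  have hgram := (gram_submatrix (commute_symm hσ) _).trans (isometryMatrix_gram hc)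
  refine ⟨(isometryMatrix x (x 0)⁻¹).submatrix σ.symm id, hgram, ?_, ?_⟩
  · rw [Matrix.det_permute, det_isometryMatrix hc, Equiv.Perm.sign_symm, hsign]
    simp
  · rw [conj_basePoint hgram, ← hx, ← isometryMatrix_submatrix_transpose x (x 0)⁻¹]
    rfl

theorem mem_nilpotentOrbit_iff {A : Matrix Idx Idx ℂ} (hA : A ∈ orbitClosure) :
    A ∈ nilpotentOrbit ↔ A ≠ 0 :=
  ⟨fun h hA0 => zero_notMem_nilpotentOrbit (hA0 ▸ h), mem_nilpotentOrbit hA⟩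

theorem orbitClosure_eq : orbitClosure = nilpotentOrbit ∪ {0} := by
  refine Set.Subset.antisymm (fun A hA => ?_) (Set.union_subset nilpotentOrbit_subset
    (Set.singleton_subset_iff.mpr zero_mem_orbitClosure))
  exact (eq_or_ne A 0).elim Or.inr fun hA0 => Or.inl (mem_nilpotentOrbit hA hA0)

end Orbit

/-! ### The orbit as an open subscheme -/

section Reduced

theorem exists_comp_polynomial_eq {S : Type*} [CommRing S] [Algebra ℂ S]
    (φ : OrbitClosureRing →ₐ[ℂ] S) {i j : Idx} (hji : j ≠ i) (hji' : j ≠ i.swap)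
    (hu : IsUnit (φ (coord orbitMatrix i j))) :
    ∃ (θ : OrbitClosureRing →ₐ[ℂ] MvPolynomial (Fin 6) ℂ) (ψ : MvPolynomial (Fin 6) ℂ →ₐ[ℂ] S),
      ψ.comp θ = φ := by
  obtain ⟨σ, hσ, -, rfl, rfl⟩ := exists_even_perm_commute_swap hji hji'
  obtain ⟨x, -, hx⟩ := (isClosurePoint_orbitMatrix.map φ.toRingHom).exists_eq_nuMap_chartMatrix
    (isUnit_two_of_complexAlgebra S) hσ hu
  let chart : Matrix (Fin 2) Idx (MvPolynomial (Fin 6) ℂ) :=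
    (chartMatrix MvPolynomial.X).submatrix id σ.symm
  have hchart : IsClosurePoint (nuMap chart) :=
    isClosurePoint_nuMap (momentMap_submatrix (commute_symm hσ) (momentMap_chartMatrix _))
  have hchart_map : chart.map (MvPolynomial.aeval (R := ℂ) x) =
      (chartMatrix x).submatrix id σ.symm := by
    have h := chartMatrix_map (MvPolynomial.aeval (R := ℂ) x).toRingHom MvPolynomial.X
    simp only [AlgHom.toRingHom_eq_coe, RingHom.coe_coe, MvPolynomial.aeval_X] at h
    rw [← h]
    rfl
  refine ⟨orbitLift (nuMap chart) hchart, MvPolynomial.aeval x, orbit_algHom_ext ?_⟩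
  rw [AlgHom.coe_comp, ← Matrix.map_map, orbitMatrix_map_lift, ← nuMap_map_algHom, hchart_map, hx]
  rfl

theorem isReduced_of_isLocalization {R S : Type*} [CommRing R] [CommRing S] [Algebra R S]
    (M : Submonoid R) [IsLocalization M S]
    (h : ∀ f : R, IsNilpotent f → algebraMap R S f = 0) : _root_.IsReduced S := by
  refine ⟨fun z ⟨n, hz⟩ => ?_⟩
  obtain ⟨f, s, rfl⟩ := IsLocalization.exists_mk'_eq M z
  rw [← IsLocalization.mk'_pow, IsLocalization.mk'_eq_zero_iff] at hz
  obtain ⟨u, hu⟩ := hz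
  have hnil : IsNilpotent (u * f : R) := ⟨n + 1, by
    linear_combination (exp := 1) (u : R) ^ n * f * hu⟩
  have huf := h _ hnil
  rw [map_mul, (IsLocalization.map_units S u).mul_right_eq_zero] at huf
  rw [← IsLocalization.mk'_spec' S f s, (IsLocalization.map_units S s).mul_right_eq_zero] at huf
  exact huf

theorem isReduced_localization_orbitClosureRing (p : Ideal OrbitClosureRing) [p.IsPrime]
    (hp : ∃ i j, coord orbitMatrix i j ∉ p) : _root_.IsReduced (Localization.AtPrime p) := by
  obtain ⟨i, j, hji, hji', hij⟩ := isClosurePoint_orbitMatrix.exists_isotropic_coord_notMem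
    (isUnit_two_of_complexAlgebra _) p hp
  let φ : OrbitClosureRing →ₐ[ℂ] Localization.AtPrime p :=
    Algebra.algHom ℂ OrbitClosureRing (Localization.AtPrime p)
  have hu : IsUnit (φ (coord orbitMatrix i j)) :=
    IsLocalization.map_units (Localization.AtPrime p) (⟨_, hij⟩ : p.primeCompl)
  obtain ⟨θ, ψ, hψθ⟩ := exists_comp_polynomial_eq (S := Localization.AtPrime p) φ hji hji' hu
  refine isReduced_of_isLocalization (S := Localization.AtPrime p) p.primeCompl fun f hf => ?_
  have hφ := DFunLike.congr_fun hψθ f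
  rw [AlgHom.comp_apply, (hf.map θ).eq_zero, map_zero] at hφ
  exact hφ.symm

theorem isReduced_toScheme_of_localization {R : CommRingCat} (U : (Spec R).Opens)
    (H : ∀ x : PrimeSpectrum R, x ∈ (U : TopologicalSpace.Opens (PrimeSpectrum R)) →
      _root_.IsReduced (Localization.AtPrime x.asIdeal)) :
    IsReduced U.toScheme := by
  have hstalk (x : U.toScheme) : _root_.IsReduced (U.toScheme.presheaf.stalk x) := by
    let q : PrimeSpectrum R := x.1
    have hq : _root_.IsReduced (Localization.AtPrime q.asIdeal) := H q x.2
    have hq_stalk : _root_.IsReduced ((Spec R).presheaf.stalk x.1) :=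
      isReduced_of_injective (Spec.stalkIso R x.1).hom.hom
        (Spec.stalkIso R x.1).commRingCatIsoToRingEquiv.injective
    exact isReduced_of_injective (U.stalkIso x).hom.hom
      (U.stalkIso x).commRingCatIsoToRingEquiv.injective
  exact isReduced_of_isReduced_stalk _

end Reduced

section OrbitOpen

/-- The orbit as an open subscheme of its closure: the union of the open subsets where one of the
coordinates is invertible. -/
def orbitOpen : orbitClosureScheme.Opens :=
  ⨆ p : Idx × Idx, PrimeSpectrum.basicOpen (coord orbitMatrix p.1 p.2)

theorem mem_orbitOpen {x : PrimeSpectrum OrbitClosureRing} :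
    x ∈ (orbitOpen : TopologicalSpace.Opens (PrimeSpectrum OrbitClosureRing)) ↔
      ∃ i j, coord orbitMatrix i j ∉ x.asIdeal := by
  refine (TopologicalSpace.Opens.mem_iSup (x := x)).trans ?_
  simp only [PrimeSpectrum.mem_basicOpen, Prod.exists]

theorem closedPoint_mem_orbitOpen_iff (A : Matrix Idx Idx ℂ) (hA : A ∈ orbitClosure) :
    closedPoint A hA ∈ orbitOpen ↔ A ∈ nilpotentOrbit := by
  rw [mem_nilpotentOrbit_iff hA]
  have coord_notMem (i j : Idx) :
      coord orbitMatrix i j ∉ PrimeSpectrum.asIdeal (closedPoint A hA) ↔ coord A i j ≠ 0 := by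
    rw [← coord_evalAt A hA]
    rfl
  refine mem_orbitOpen.trans ⟨?_, fun hA0 => ?_⟩
  · rintro ⟨i, j, hij⟩ rfl
    exact (coord_notMem i j).mp hij rfl
  · obtain ⟨i, j, hij⟩ := exists_coord_ne_zero hA0
    exact ⟨i, j, (coord_notMem i j).mpr hij⟩

theorem isReduced_orbitOpen : IsReduced orbitOpen.toScheme :=
  isReduced_toScheme_of_localization (R := CommRingCat.of OrbitClosureRing) _ fun x hx =>
    isReduced_localization_orbitClosureRing x.asIdeal (mem_orbitOpen.mp hx)

theorem flat_nu_orbitOpen : Flat (nu ∣_ orbitOpen) := by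
  refine flat_morphismRestrict_of_basicOpen (CommRingCat.ofHom nuComorphism.toRingHom) orbitOpen
    fun x hx => ?_
  obtain ⟨i, j, hij⟩ := mem_orbitOpen.mp hx
  exact ⟨coord orbitMatrix i j, hij,
    le_iSup (fun p : Idx × Idx => PrimeSpectrum.basicOpen (coord orbitMatrix p.1 p.2)) (i, j),
    flat_awayMap_coord i j⟩

end OrbitOpen

section Dense

open Polynomial

/-- The matrix whose image under `ν` is `t A₀`, where `t` is the variable. -/
def lineMatrix : Matrix (Fin 2) Idx ℂ[X] :=
  Matrix.of ![Pi.single (Sum.inl 0) X, Pi.single (Sum.inl 1) 1]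

theorem momentMap_lineMatrix : momentMap lineMatrix = 0 := by
  refine momentMap_eq_zero_iff.mpr fun a b => ?_
  fin_cases a <;> fin_cases b <;> simp [lineMatrix, Pi.single_apply]

/-- The line `t ↦ t A₀` in the orbit closure. -/
def orbitLine : OrbitClosureRing →ₐ[ℂ] ℂ[X] :=
  orbitLift (nuMap lineMatrix) (isClosurePoint_nuMap momentMap_lineMatrix)

theorem aeval_zero_comp_orbitLine :
    (aeval (0 : ℂ)).comp orbitLine = evalAt 0 zero_mem_orbitClosure := by
  refine orbit_algHom_ext ?_
  rw [AlgHom.coe_comp, ← Matrix.map_map, orbitLine, orbitMatrix_map_lift, orbitMatrix_map_evalAt,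
    ← nuMap_map_algHom]
  ext k l
  rw [nuMap_apply]
  simp [lineMatrix, Pi.single_apply, apply_ite]

theorem orbitLine_coord : orbitLine (coord orbitMatrix (.inl 0) (.inl 1)) = X := by
  rw [← coord_map orbitLine, orbitLine, orbitMatrix_map_lift, coord_nuMap]
  simp [lineMatrix]

theorem ker_evalAt_zero_le {p : Ideal OrbitClosureRing} (hp : ∀ i j, coord orbitMatrix i j ∈ p) :
    RingHom.ker (evalAt 0 zero_mem_orbitClosure) ≤ p := by
  have h : Ideal.Quotient.mkₐ ℂ p =
      (Algebra.ofId ℂ (OrbitClosureRing ⧸ p)).comp (evalAt 0 zero_mem_orbitClosure) := by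
    refine orbit_algHom_ext (S := OrbitClosureRing ⧸ p) (ext_coord fun i j => ?_)
    rw [AlgHom.coe_comp, ← Matrix.map_map, orbitMatrix_map_evalAt, coord_map, coord_map]
    exact (Ideal.Quotient.eq_zero_iff_mem.mpr (hp i j)).trans (map_zero _).symm
  intro f hf
  have hf' := DFunLike.congr_fun h f
  rw [AlgHom.comp_apply, RingHom.mem_ker.mp hf, map_zero] at hf'
  exact Ideal.Quotient.eq_zero_iff_mem.mp hf'

/-- The line `t ↦ t A₀` joins the orbit to the only other point `0`. -/
theorem dense_orbitOpen : Dense (orbitOpen : Set orbitClosureScheme) := by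
  let y : PrimeSpectrum OrbitClosureRing := PrimeSpectrum.comap orbitLine.toRingHom ⊥
  have hy : y ∈ (orbitOpen : TopologicalSpace.Opens (PrimeSpectrum OrbitClosureRing)) := by
    refine mem_orbitOpen.mpr ⟨.inl 0, .inl 1, fun h => X_ne_zero (R := ℂ) ?_⟩
    rw [← orbitLine_coord]
    exact h
  intro (x : PrimeSpectrum OrbitClosureRing)
  by_cases hx : x ∈ (orbitOpen : TopologicalSpace.Opens (PrimeSpectrum OrbitClosureRing))
  · exact subset_closure hx
  · have hcoord : ∀ i j, coord orbitMatrix i j ∈ x.asIdeal := by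
      by_contra! h
      exact hx (mem_orbitOpen.mpr h)
    have hyx : y ≤ x := fun f hf => ker_evalAt_zero_le hcoord <| by
      rw [← aeval_zero_comp_orbitLine, RingHom.mem_ker, AlgHom.comp_apply,
        show orbitLine f = 0 from hf, map_zero]
    exact closure_mono (Set.singleton_subset_iff.mpr hy)
      ((PrimeSpectrum.le_iff_mem_closure y x).mp hyx)

end Dense

/-! ### Functions on `SL₂` and the Hilbert function -/

section SpecialLinear

open MvPolynomial

theorem irreducible_det_genM_sub_one : Irreducible ((genM (Fin 2)).det - 1) := by
  have hdet : (genM (Fin 2)).det - 1 = X (0, 0) * X (1, 1) + (-(X (0, 1) * X (1, 0)) - 1) := by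
    rw [Matrix.det_fin_two]
    simp only [genM, Matrix.mvPolynomialX_apply]
    ring
  rw [hdet]
  refine irreducible_mul_X_add _ _ _ (X_ne_zero _) (by simp) (fun h => ?_) ?_
  · have h' := vars_sub_subset _ h
    simp only [vars_neg, vars_one, Finset.union_empty] at h'
    simpa using vars_mul _ _ h'
  · rw [X_prime.irreducible.isRelPrime_iff_not_dvd]
    intro h
    simpa using map_dvd (aeval (0 : Fin 2 × Fin 2 → ℂ)) h

theorem eq_zero_of_sl2Lift {f : SL2Ring} (hf : ∀ h : SL(2, ℂ), sl2Lift h f = 0) : f = 0 := by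
  obtain ⟨p, rfl⟩ := Ideal.Quotient.mk_surjective f
  have hprime : (Ideal.span {(genM (Fin 2)).det - 1}).IsPrime :=
    (Ideal.span_singleton_prime irreducible_det_genM_sub_one.ne_zero).mpr
      irreducible_det_genM_sub_one.prime
  rw [Ideal.Quotient.eq_zero_iff_mem, ← IsPrime.vanishingIdeal_zeroLocus (K := ℂ)
    (Ideal.span {(genM (Fin 2)).det - 1})]
  intro x hx
  have hdet : (Matrix.of fun i j => x (i, j)).det = 1 := by
    have h := hx _ (Ideal.mem_span_singleton_self _)
    rw [map_sub, map_one, AlgHom.map_det, AlgHom.mapMatrix_apply, sub_eq_zero] at h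
    rw [← genM_map_aeval (Matrix.of fun i j => x (i, j))]
    exact h
  exact hf ⟨_, hdet⟩

theorem sl2Lift_comp_action (g h : SL(2, ℂ)) :
    (sl2Lift h).comp (sl2Action g) = sl2Lift (g⁻¹ * h) := by
  refine sl2_algHom_ext ?_
  rw [AlgHom.coe_comp, ← Matrix.map_map, sl2Matrix_map_action, map_mul_algHom,
    map_algebraMap_map_algHom, sl2Matrix_map_lift, sl2Matrix_map_lift]
  rfl

theorem sl2Lift_action (g h : SL(2, ℂ)) (f : SL2Ring) :
    sl2Lift h (sl2Action g f) = sl2Lift (g⁻¹ * h) f :=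
  DFunLike.congr_fun (sl2Lift_comp_action g h) f

end SpecialLinear

section Frobenius

open scoped TensorProduct

variable {V : Type*} [AddCommGroup V] [Module ℂ V] {ρ : Representation ℂ SL(2, ℂ) V}

/-- The regular functions on `SL₂` as a representation of `SL₂(ℂ)`. -/
def sl2Rep : Representation ℂ SL(2, ℂ) SL2Ring :=
  (AlgHom.toEnd (R := ℂ) (A := SL2Ring)).comp sl2Action

theorem sl2Lift_intertwiningMap (φ : ρ.IntertwiningMap sl2Rep) (h : SL(2, ℂ)) (v : V) :
    sl2Lift h (φ v) = sl2Lift (1 : SL(2, ℂ)) (φ (ρ h⁻¹ v)) := by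
  rw [φ.isIntertwining ρ sl2Rep]
  refine Eq.trans ?_ (sl2Lift_action h⁻¹ 1 (φ v)).symm
  rw [inv_inv, mul_one]

/-- Evaluation at `1 ∈ SL₂`: the map of Frobenius reciprocity for functions on `SL₂`. -/
def evalOne (ρ : Representation ℂ SL(2, ℂ) V) :
    ρ.IntertwiningMap sl2Rep →ₗ[ℂ] Module.Dual ℂ V :=
  (sl2Lift (1 : SL(2, ℂ))).toLinearMap.compRight ℂ ∘ₗ
    Representation.IntertwiningMap.toLinearMapl ρ sl2Rep

theorem evalOne_injective (ρ : Representation ℂ SL(2, ℂ) V) : Function.Injective (evalOne ρ) := by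
  refine (injective_iff_map_eq_zero _).mpr fun φ hφ => DFunLike.ext _ _ fun v => ?_
  refine eq_zero_of_sl2Lift fun h => ?_
  rw [sl2Lift_intertwiningMap]
  exact LinearMap.congr_fun hφ (ρ h⁻¹ v)

/-- A coaction `c` of the Hopf algebra `ℂ[SL₂]` integrating `ρ` turns a linear form into the
equivariant map formed by its matrix coefficients. -/
theorem evalOne_surjective (c : V →ₗ[ℂ] SL2Ring ⊗[ℂ] V)
    (hc : ∀ (h : SL(2, ℂ)) (v : V),
      TensorProduct.lid ℂ V ((sl2Lift h).toLinearMap.rTensor V (c v)) = ρ h⁻¹ v) :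
    Function.Surjective (evalOne ρ) := by
  intro l
  let φ : V →ₗ[ℂ] SL2Ring := TensorProduct.rid ℂ SL2Ring ∘ₗ l.lTensor SL2Ring ∘ₗ c
  have contract_comm (h : SL(2, ℂ)) (t : SL2Ring ⊗[ℂ] V) :
      sl2Lift h (TensorProduct.rid ℂ SL2Ring (l.lTensor SL2Ring t)) =
        l (TensorProduct.lid ℂ V ((sl2Lift h).toLinearMap.rTensor V t)) := by
    induction t with
    | zero => simp
    | tmul a v => simp [mul_comm]
    | add s t hs ht => simp only [map_add, hs, ht]
  have sl2Lift_φ (h : SL(2, ℂ)) (v : V) : sl2Lift h (φ v) = l (ρ h⁻¹ v) :=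
    (contract_comm h (c v)).trans (congrArg l (hc h v))
  refine ⟨⟨φ, fun g => LinearMap.ext fun v => ?_⟩, LinearMap.ext fun v => ?_⟩
  · refine sub_eq_zero.mp (eq_zero_of_sl2Lift fun h => ?_)
    rw [map_sub, sub_eq_zero, LinearMap.comp_apply, sl2Lift_φ]
    refine Eq.trans ?_ (sl2Lift_action g h (φ v)).symm
    rw [sl2Lift_φ, mul_inv_rev, inv_inv, map_mul, Module.End.mul_apply]
  · refine (sl2Lift_φ 1 v).trans ?_
    rw [inv_one, map_one, Module.End.one_apply]

theorem evalOne_surjective_of_injective {W : Type*} [AddCommGroup W] [Module ℂ W]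
    {τ : Representation ℂ SL(2, ℂ) W} (i : ρ.IntertwiningMap τ) (hi : Function.Injective i)
    (hτ : Function.Surjective (evalOne τ)) : Function.Surjective (evalOne ρ) := by
  intro l
  obtain ⟨l', hl'⟩ := LinearMap.exists_leftInverse_of_injective i.toLinearMap
    (LinearMap.ker_eq_bot.mpr hi)
  obtain ⟨φ, hφ⟩ := hτ (l ∘ₗ l')
  refine ⟨φ.comp i, LinearMap.ext fun v => ?_⟩
  exact (LinearMap.congr_fun hφ (i v)).trans (congrArg l (LinearMap.congr_fun hl' v))

end Frobenius

section BinaryForms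

open MvPolynomial
open scoped TensorProduct

/-- The coaction `f ↦ (x ↦ f (G x))` of `ℂ[SL₂]` on the polynomial functions on `ℂ²`, where `G` is
the generic element of `SL₂`. -/
def coaction : MvPolynomial (Fin 2 × Unit) ℂ →ₐ[ℂ] SL2Ring ⊗[ℂ] MvPolynomial (Fin 2 × Unit) ℂ :=
  aeval fun p : Fin 2 × Unit => ∑ k, sl2Matrix p.1 k ⊗ₜ[ℂ] X (R := ℂ) (k, p.2)

theorem lid_rTensor_coaction (h : SL(2, ℂ)) (f : MvPolynomial (Fin 2 × Unit) ℂ) :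
    TensorProduct.lid ℂ _ ((sl2Lift h).toLinearMap.rTensor _ (coaction f)) =
      polyAction Unit h⁻¹ f := by
  have hcomp : ((Algebra.TensorProduct.lid ℂ _).toAlgHom.comp
      (Algebra.TensorProduct.map (sl2Lift h) (AlgHom.id ℂ _))).comp coaction =
        polyAction Unit h⁻¹ := by
    ext ⟨a, j⟩ : 1
    have hentry (k : Fin 2) : sl2Lift h (sl2Matrix a k) = h.1 a k :=
      congrFun₂ (sl2Matrix_map_lift h) a k
    rw [polyAction_X, inv_inv]
    simp [coaction, hentry, Algebra.smul_def]
  exact DFunLike.congr_fun hcomp f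

theorem rank_homogeneousSubmodule (σ R : Type*) [Fintype σ] [CommRing R] [Nontrivial R] (d : ℕ) :
    Module.rank R (homogeneousSubmodule σ R d) = (Nat.multichoose (Fintype.card σ) d : ℕ) := by
  classical
  let E := Finset.finsuppAntidiag (Finset.univ : Finset σ) d
  have hE : {m : σ →₀ ℕ | m.degree = d} = E := by
    ext m
    simp [E, Finsupp.degree_eq_sum]
  have hE_submodule : homogeneousSubmodule σ R d = restrictSupport R E := by
    rw [← hE]
    exact homogeneousSubmodule_eq_finsupp_supported σ R d
  rw [hE_submodule, rank_eq_card_basis (basisRestrictSupport R (E : Set (σ →₀ ℕ))),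
    ← Finset.card_univ (α := σ), ← Finset.card_finsuppAntidiag_nat_eq_multichoose]
  exact congrArg Nat.cast (Fintype.card_coe E)

theorem rank_dual_binaryForms (d : ℕ) :
    Module.rank ℂ (Module.Dual ℂ (BinaryForms d)) = (d : Cardinal) + 1 := by
  have : Module.Finite ℂ (BinaryForms d) :=
    Module.Finite.iff_fg.mpr (homogeneousSubmodule_fg _ _ d)
  rw [Module.dual_rank_eq, Cardinal.lift_id, rank_homogeneousSubmodule, Fintype.card_prod,
    Fintype.card_fin, Fintype.card_unit, mul_one, Nat.multichoose_two, Nat.cast_add, Nat.cast_one]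

/-- The polynomial functions on `ℂ²` as a representation of `SL₂(ℂ)`. -/
def polynomialRep : Representation ℂ SL(2, ℂ) (MvPolynomial (Fin 2 × Unit) ℂ) :=
  (AlgHom.toEnd (R := ℂ) (A := MvPolynomial (Fin 2 × Unit) ℂ)).comp (polyAction Unit)

theorem evalOne_polynomialRep_surjective : Function.Surjective (evalOne polynomialRep) :=
  evalOne_surjective coaction.toLinearMap lid_rTensor_coaction

theorem evalOne_binaryFormsRep_bijective (d : ℕ) :
    Function.Bijective (evalOne (binaryFormsRep d)) :=
  ⟨evalOne_injective _, evalOne_surjective_of_injective (τ := polynomialRep)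
    ⟨(BinaryForms d).subtype, fun _ => rfl⟩ Subtype.val_injective evalOne_polynomialRep_surjective⟩

end BinaryForms

section Multiplicity

universe u

open Representation

theorem rank_intertwiningMap_congr {k G V : Type*} {W W' : Type u} [CommRing k] [Monoid G]
    [AddCommGroup V] [AddCommGroup W] [AddCommGroup W'] [Module k V] [Module k W] [Module k W']
    (ρ : Representation k G V) {τ : Representation k G W} {τ' : Representation k G W'}
    (e : τ.Equiv τ') :
    Module.rank k (ρ.IntertwiningMap τ) = Module.rank k (ρ.IntertwiningMap τ') :=
  LinearEquiv.rank_eq <| LinearEquiv.ofLinearMap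
    (IntertwiningMap.llcomp ρ τ τ' e.toIntertwiningMap)
    (IntertwiningMap.llcomp ρ τ' τ e.symm.toIntertwiningMap)
    (LinearMap.ext fun φ => DFunLike.ext _ _ fun v => e.apply_symm_apply (φ v))
    (LinearMap.ext fun φ => DFunLike.ext _ _ fun v => e.symm_apply_apply (φ v))

theorem multiplicity_eq {A : Matrix Idx Idx ℂ} (hA : A ∈ orbitClosure) (hA0 : A ≠ 0) (d : ℕ) :
    multiplicity A hA d = (d : Cardinal) + 1 := by
  obtain ⟨e, he⟩ := exists_algEquiv_sl2Ring hA hA0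
  let e' : (fibreRep A hA).Equiv sl2Rep :=
    Representation.Equiv.mk e.toLinearEquiv fun g => LinearMap.ext (he g)
  rw [multiplicity, rank_intertwiningMap_congr _ e', ← rank_dual_binaryForms d]
  exact (LinearEquiv.ofBijective _ (evalOne_binaryFormsRep_bijective d)).rank_eq

end Multiplicity

end SymplecticReduction

end

theorem mainTheorem8 :
    -- the orbit closure consists of the orbit and zero
    SymplecticReduction.orbitClosure = SymplecticReduction.nilpotentOrbit ∪ {0} ∧
    -- the orbit is (the set of closed points of) a dense open reduced subscheme `U`
    ∃ U : SymplecticReduction.orbitClosureScheme.Opens,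
      (∀ (A : Matrix SymplecticReduction.Idx SymplecticReduction.Idx ℂ)
        (hA : A ∈ SymplecticReduction.orbitClosure),
        SymplecticReduction.closedPoint A hA ∈ U ↔ A ∈ SymplecticReduction.nilpotentOrbit) ∧
      Dense (U : Set SymplecticReduction.orbitClosureScheme) ∧
      AlgebraicGeometry.IsReduced U.toScheme ∧
      -- the restriction of `ν` over the orbit is flat
      AlgebraicGeometry.Flat (SymplecticReduction.nu ∣_ U) ∧
      -- the fibres over the orbit are isomorphic to each other
      (∀ (A B : Matrix SymplecticReduction.Idx SymplecticReduction.Idx ℂ)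
        (hA : A ∈ SymplecticReduction.orbitClosure) (hB : B ∈ SymplecticReduction.orbitClosure),
        A ∈ SymplecticReduction.nilpotentOrbit → B ∈ SymplecticReduction.nilpotentOrbit →
        Nonempty (SymplecticReduction.FibreRing A hA ≃ₐ[ℂ]
          SymplecticReduction.FibreRing B hB)) ∧
      -- they are isomorphic to `SL₂`, equivariantly, and have Hilbert function `d ↦ d + 1`
      (∀ (A : Matrix SymplecticReduction.Idx SymplecticReduction.Idx ℂ)
        (hA : A ∈ SymplecticReduction.orbitClosure),
        A ∈ SymplecticReduction.nilpotentOrbit →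
        (∃ e : SymplecticReduction.FibreRing A hA ≃ₐ[ℂ] SymplecticReduction.SL2Ring,
          ∀ (g : Matrix.SpecialLinearGroup (Fin 2) ℂ) (f : SymplecticReduction.FibreRing A hA),
            e (SymplecticReduction.fibreAction A hA g f) =
              SymplecticReduction.sl2Action g (e f)) ∧
        ∀ d : ℕ, SymplecticReduction.multiplicity A hA d = (d : Cardinal) + 1) := by
  refine ⟨SymplecticReduction.orbitClosure_eq, SymplecticReduction.orbitOpen,
    SymplecticReduction.closedPoint_mem_orbitOpen_iff, SymplecticReduction.dense_orbitOpen,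
    SymplecticReduction.isReduced_orbitOpen, SymplecticReduction.flat_nu_orbitOpen, ?_, ?_⟩
  · intro A B hA hB hA' hB'
    obtain ⟨e, -⟩ := SymplecticReduction.exists_algEquiv_sl2Ring hA
      ((SymplecticReduction.mem_nilpotentOrbit_iff hA).mp hA')
    obtain ⟨e', -⟩ := SymplecticReduction.exists_algEquiv_sl2Ring hB
      ((SymplecticReduction.mem_nilpotentOrbit_iff hB).mp hB')
    exact ⟨e.trans e'.symm⟩
  · intro A hA hA'
    have hA0 := (SymplecticReduction.mem_nilpotentOrbit_iff hA).mp hA'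
    exact ⟨SymplecticReduction.exists_algEquiv_sl2Ring hA hA0,
      SymplecticReduction.multiplicity_eq hA hA0⟩
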